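/- An \emph{abelian processor} with input alphabet $I$ and state space $Q$ is a family of commuting maps $t_a:Q\to Q$ ($a\in I$); its \emph{transition monoid} is the submonoid of $\mathrm{End}(Q)$ generated by the $t_a$. Let $G=(V,E)$ be a finite directed graph (loops and multiple edges allowed) and let $A_v$ ($v\in V$) be finite alphabets, $A=\bigsqcup_v A_v$. A \emph{finite abelian network} $\mathcal N$ on $G$ with total alphabet $A$ consists of, for each $v\in V$, an abelian processor with input alphabet $A_v$ and finite state space $Q_v$, together with message functions assigning to each letter $a\in A_v$, outgoing edge $(v,u)$ and state $q \in Q_v$ a word in $A_u^*$ (sent along the edge when $a$ is processed in state $q$), such that two input words that are equal up to permutation, read from the same state, produce on each edge output words that are equal up to permutation. A total state $\mathbf x.\mathbf q$ consists of a vector $\mathbf x\in\mathbb Z^A$ of waiting letters and a state $\mathbf q\in Q=\prod_v Q_v$; processing a letter $a\in A_v$ removes one $a$, applies $t_a$ to $\mathbf q_v$ and adds the letters sent. An execution is \emph{legal} if each letter is present when it is processed, and \emph{complete} if no letters remain at its end. $\mathcal N$ \emph{halts on all inputs} if every $\mathbf x.\mathbf q$ with $\mathbf x\in\mathbb N^A$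 has a complete legal execution. In that case the final state is independent of the execution; let $\tau_a(\mathbf q)$ be the final state for the input $1_a.\mathbf q$, let $M\subset \mathrm{End}(Q)$ be the (finite commutative) monoid generated by the $\tau_a$, and let $e$ be its minimal idempotent, i.e. the product of all its idempotents. The \emph{critical group} $\mathrm{Crit}\,\mathcal N$ is the finite abelian group $eM$. $\mathcal N$ is \emph{irreducible} if for each $v$ the transition monoid $M_v$ of the processor at $v$ acts irreducibly on $Q_v$: $Q_v\neq\emptyset$, and for all $q,q'\in Q_v$ there are $m,m'\in M_v$ with $mq=m'q'$. Let $e_v$ be the minimal idempotent of $M_v$. Each $t_a$, $a\in A_v$, permutes $e_vQ_v$, so $\mathbb Z^{A_v}$ acts on $e_vQ_v$; let $K_v$ be the kernel of this action. The \emph{total kernel} is $K=\prod_v K_v\subset\mathbb Z^A$. If $\mathbf k\in K\cap\mathbb N^A$, then processing $\mathbf k_a$ letters $a$ for each $a\in A$, starting from a locally recurrent state $\mathbf q\in\prod_v e_vQ_v$, returns the network to the state $\mathbf q$; let $P(\mathbf k)\in\mathbb N^A$ be the vector of letters sent. For irreducible $\mathcal N$ this does not depend on $\mathbf q$, and $P$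 extends uniquely to a homomorphism $P:K\to\mathbb Z^A$, the \emph{production map}. Irreducible abelian networks on the same graph with the same total alphabet are \emph{homotopic} if they have the same total kernel and the same production map. \textbf{Corollary.} (1) If $\mathcal N$ and $\mathcal N'$ are homotopic finite irreducible abelian networks that halt on all inputs, then $\mathrm{Crit}\,\mathcal N\simeq\mathrm{Crit}\,\mathcal N'$. (2) Let $s\in V$ be a vertex such that from every other vertex there is a directed path to $s$, and let $d_v$ be the outdegree of $v$. Let $\mathtt{Sand}(G,s)$ and $\mathtt{Rotor}(G,s)$ be the networks with $A_v=\{v\}$ for all $v$ in which $s$ has one state and never sends a message, and each $v\ne s$ has state space $\mathbb Z/d_v\mathbb Z$ and transition $q\mapsto q+1$; in $\mathtt{Sand}(G,s)$ the processor at $v\neq s$ sends one letter along each outgoing edge whenever it passes from state $d_v-1$ to state $0$, and in $\mathtt{Rotor}(G,s)$, for a fixed ordering $e_1,\dots,e_{d_v}$ of the outgoing edges of each $v$, it sends exactly one letter, along $e_{q+1}$, whenever it passes from state $q\in\{0,\dots,d_v-1\}$ to $q+1$ modulo $d_v$. Then $\mathtt{Rotor}(G,s)$ and $\mathtt{Sand}(G,s)$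 are homotopic (in particular irreducible), both halt on all inputs, and $\mathrm{Crit}\,\mathtt{Rotor}(G,s)\simeq\mathrm{Crit}\,\mathtt{Sand}(G,s)$. -/

import Mathlib

/-! ### Finite commutative monoids: minimal idempotent, the group `eM`, its action on `eX` -/

section MonoidTheory

variable (M : Type*) [CommMonoid M]

/-- The minimal idempotent `e`: the product of all idempotents of a finite commutative monoid. -/
noncomputable def minIdem : M := ∏ᶠ f : {f : M // IsIdempotentElem f}, (f : M)

variable {M}

theorem exists_idempotent_pow [Finite M] (m : M) : ∃ j : ℕ, IsIdempotentElem (m ^ (j + 1)) := by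
  obtain ⟨a, b, hab, h⟩ := Finite.exists_ne_map_eq_of_infinite (fun n : ℕ => m ^ n)
  wlog hlt : a < b generalizing a b
  · exact this b a hab.symm h.symm (by omega)
  have h : m ^ a = m ^ b := h
  have per : ∀ n k : ℕ, a ≤ n → m ^ (n + k * (b - a)) = m ^ n := by
    intro n k hn
    induction k with
    | zero => simp
    | succ k ih =>
      rw [← ih]
      have e1 : n + (k + 1) * (b - a) = b + (n - a + k * (b - a)) := by
        rw [Nat.add_mul]; omega
      have e2 : n + k * (b - a) = a + (n - a + k * (b - a)) := by omega
      rw [e1, pow_add, ← h, ← pow_add, ← e2]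
  have hpos : 0 < (a + 1) * (b - a) := by
    have : 0 < b - a := by omega
    positivity
  refine ⟨(a + 1) * (b - a) - 1, ?_⟩
  have hj : (a + 1) * (b - a) - 1 + 1 = (a + 1) * (b - a) := by omega
  rw [hj, IsIdempotentElem, ← pow_add]
  refine per _ _ ?_
  have : 1 ≤ b - a := by omega
  nlinarith

theorem minIdem_idem [Finite M] : IsIdempotentElem (minIdem M) := by
  classical
  have := Fintype.ofFinite {f : M // IsIdempotentElem f}
  rw [minIdem, finprod_eq_prod_of_fintype, IsIdempotentElem, ← Finset.prod_mul_distrib]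
  exact Finset.prod_congr rfl fun f _ => f.2

theorem dvd_minIdem [Finite M] (m : M) : m ∣ minIdem M := by
  obtain ⟨j, hj⟩ := exists_idempotent_pow m
  have h1 : m ∣ m ^ (j + 1) := dvd_pow_self m (by omega)
  refine h1.trans ?_
  exact finprod_mem_dvd (f := fun f : {f : M // IsIdempotentElem f} => (f : M))
    ⟨m ^ (j + 1), hj⟩ (Set.toFinite _)

variable (M) in
/-- The set `eM`, where `e` is the minimal idempotent of `M`. -/
def MinIdeal : Type _ := {m : M // ∃ n, m = minIdem M * n}

namespace MinIdeal

@[ext]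
theorem ext' {g h : MinIdeal M} (hgh : g.1 = h.1) : g = h := Subtype.ext hgh

/-- The map `m ↦ em` from `M` to `eM`. -/
noncomputable def of (m : M) : MinIdeal M := ⟨minIdem M * m, m, rfl⟩

theorem minIdem_mul_val [Finite M] (g : MinIdeal M) : minIdem M * g.1 = g.1 := by
  obtain ⟨_, n, rfl⟩ := g
  rw [← mul_assoc, minIdem_idem.eq]

/-- `eM` is an abelian group under the multiplication of `M`, with identity element `e`. -/
noncomputable instance [Finite M] : CommGroup (MinIdeal M) where
  mul g h := ⟨g.1 * h.1, g.1 * h.1, by rw [← mul_assoc, minIdem_mul_val]⟩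
  one := ⟨minIdem M, 1, by simp⟩
  inv g := of (dvd_minIdem g.1).choose
  mul_assoc a b c := Subtype.ext (mul_assoc _ _ _)
  one_mul a := Subtype.ext (minIdem_mul_val a)
  mul_one a := Subtype.ext ((mul_comm _ _).trans (minIdem_mul_val a))
  mul_comm a b := Subtype.ext (mul_comm _ _)
  inv_mul_cancel a := Subtype.ext (by
    change minIdem M * (dvd_minIdem a.1).choose * a.1 = minIdem M
    rw [mul_assoc, mul_comm _ a.1, ← (dvd_minIdem a.1).choose_spec, minIdem_idem.eq])

theorem val_mul [Finite M] (g h : MinIdeal M) : (g * h).1 = g.1 * h.1 := rfl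

theorem val_one [Finite M] : (1 : MinIdeal M).1 = minIdem M := rfl

instance [Finite M] : Finite (MinIdeal M) := Subtype.finite

end MinIdeal

variable (M) in
/-- The set `eX` of recurrent elements of a monoid action of `M` on `X`. -/
def RecElts (X : Type*) [MulAction M X] : Type _ := {x : X // ∃ y, x = minIdem M • y}

/-- The action of the group `eM` on `eX` obtained by restricting the action of `M` on `X`. -/
noncomputable instance {X : Type*} [MulAction M X] [Finite M] :
    MulAction (MinIdeal M) (RecElts M X) where
  smul g x := ⟨g.1 • x.1, g.1 • x.1, by rw [smul_smul, MinIdeal.minIdem_mul_val]⟩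
  one_smul := by
    rintro ⟨_, y, rfl⟩
    exact Subtype.ext (by
      change minIdem M • minIdem M • y = minIdem M • y
      rw [smul_smul, minIdem_idem.eq])
  mul_smul g h x := Subtype.ext (mul_smul g.1 h.1 x.1)

theorem RecElts.val_smul {X : Type*} [MulAction M X] [Finite M] (g : MinIdeal M)
    (x : RecElts M X) : (g • x).1 = g.1 • x.1 := rfl

theorem RecElts.of_smul {X : Type*} [MulAction M X] [Finite M] (m : M)
    (x : RecElts M X) : (MinIdeal.of m • x).1 = m • x.1 := by
  obtain ⟨_, y, rfl⟩ := x
  change (minIdem M * m) • minIdem M • y = m • minIdem M • y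
  rw [smul_smul, smul_smul, mul_comm, ← mul_assoc, minIdem_idem.eq, mul_comm]

variable (M) in
/-- A monoid action is irreducible if the equivalence relation
`x ∼ x' ↔ ∃ m m', m x = m' x'` has exactly one equivalence class. -/
def IsIrreducibleAction (X : Type*) [MulAction M X] : Prop :=
  Nonempty X ∧ ∀ x x' : X, ∃ m m' : M, m • x = m' • x'

end MonoidTheory

/-! ### Abelian processors -/

/-- An abelian processor with input alphabet `I` and state space `Q`: commuting transition maps. -/
structure AbelianProcessor (I Q : Type*) where
  /-- the state transition maps -/
  t : I → Function.End Q
  t_comm : ∀ a b, t a * t b = t b * t a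

namespace AbelianProcessor

variable {I Q : Type*} (P : AbelianProcessor I Q)

/-- The submonoid of `End Q` generated by the transition maps. -/
def transitionMonoid : Submonoid (Function.End Q) := Submonoid.closure (Set.range P.t)

instance : CommMonoid P.transitionMonoid :=
  { (inferInstance : Monoid P.transitionMonoid) with
    mul_comm := (Submonoid.isMulCommutative_closure (s := Set.range P.t) _ (by
      rintro _ ⟨a, rfl⟩ _ ⟨b, rfl⟩
      exact P.t_comm a b)).is_comm.comm }

instance [Finite Q] : Finite P.transitionMonoid :=
  have : Finite (Function.End Q) := inferInstanceAs (Finite (Q → Q))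
  Subtype.finite

/-- A transition map as an element of the transition monoid. -/
def gen (a : I) : P.transitionMonoid := ⟨P.t a, Submonoid.subset_closure ⟨a, rfl⟩⟩

/-- The action of the transition monoid on the state space is irreducible. -/
def Irreducible : Prop := IsIrreducibleAction P.transitionMonoid Q

/-- The group `eM` of the transition monoid `M`. -/
abbrev Grp : Type _ := MinIdeal P.transitionMonoid

/-- The recurrent states, `eQ`. -/
abbrev Rec : Type _ := RecElts P.transitionMonoid Q

/-- The homomorphism from `ℤ ^ I` to the group `eM` that sends the basis vector `1_a` to `e t_a`;
through it `ℤ ^ I` acts on `eQ`, the vector `1_a` acting by the restriction of `t_a`. -/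
noncomputable def grpElt [Finite Q] [Fintype I] (x : I → ℤ) : P.Grp :=
  ∏ a, (MinIdeal.of (P.gen a)) ^ x a

theorem grpElt_add [Finite Q] [Fintype I] (x y : I → ℤ) :
    P.grpElt (x + y) = P.grpElt x * P.grpElt y := by
  simp [grpElt, zpow_add, Finset.prod_mul_distrib]

theorem grpElt_zero [Finite Q] [Fintype I] : P.grpElt 0 = 1 := by
  simp [grpElt]

theorem grpElt_single [Finite Q] [Fintype I] [DecidableEq I] (a : I) :
    P.grpElt (Pi.single a 1) = MinIdeal.of (P.gen a) := by
  rw [grpElt, Finset.prod_eq_single a]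
  · simp
  · intro b _ hb
    simp [hb]
  · simp

/-- The kernel of the action of `ℤ ^ I` on `eQ`. -/
noncomputable def kernel [Finite Q] [Fintype I] : AddSubgroup (I → ℤ) where
  carrier := {x | ∀ q : P.Rec, P.grpElt x • q = q}
  zero_mem' q := by rw [grpElt_zero, one_smul]
  add_mem' {x y} hx hy q := by rw [grpElt_add, mul_smul, hy, hx]
  neg_mem' {x} hx q := by
    conv_lhs => rw [← hx q]
    rw [smul_smul, ← grpElt_add, neg_add_cancel, grpElt_zero, one_smul]

end AbelianProcessor

/-- The word output by an automaton with transition maps `t` and message passing functions `o`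
when it reads an input word starting from a given state. -/
def outputWord {I Q B : Type*} (t : I → Function.End Q) (o : I → Q → List B) :
    List I → Q → List B
  | [], _ => []
  | a :: w, q => o a q ++ outputWord t o w (t a q)

/-- An abelian processor with input alphabet `I`, state space `Q` and output alphabets `B u`. -/
structure OutputProcessor (I Q : Type*) {U : Type*} (B : U → Type*) extends
    AbelianProcessor I Q where
  /-- the message passing functions -/
  o : I → (u : U) → Q → List (B u)
  /-- input words equal up to permutation give output words equal up to permutation -/
  o_perm : ∀ w w' : List I, w.Perm w' → ∀ (u : U) (q : Q),
    (outputWord t (fun a => o a u) w q).Perm (outputWord t (fun a => o a u) w' q)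

/-! ### Abelian networks -/

set_option linter.unusedSectionVars false

universe uV uE uA uQ uQ'

/-- An abelian network on the directed graph (quiver; loops and multiple edges are allowed) with
vertex set `V`, where the processor at `v` has input alphabet `A v` and, for each outgoing edge
of `v`, the input alphabet of the endpoint of that edge as output alphabet. -/
structure AbelianNetwork (V : Type uV) [Quiver.{uE + 1} V] (A : V → Type uA) where
  /-- the state spaces -/
  Q : V → Type uQ
  /-- the processors -/
  proc : ∀ v, OutputProcessor (A v) (Q v) (fun e : Quiver.Star v => A e.1)

/-- The total alphabet, the disjoint union of the alphabets `A v`. -/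
abbrev Letter {V : Type*} (A : V → Type*) : Type _ := Σ v, A v

namespace AbelianNetwork

variable {V : Type uV} [Quiver.{uE + 1} V] {A : V → Type uA}

/-- States of the network: a state of each processor. -/
abbrev State (N : AbelianNetwork.{uV, uE, uA, uQ} V A) : Type _ := ∀ v, N.Q v

/-- Total states `x.q`: numbers of waiting letters (possibly negative), and a state. -/
abbrev TotalState (N : AbelianNetwork.{uV, uE, uA, uQ} V A) : Type _ := (Letter A → ℤ) × N.State

variable (N : AbelianNetwork.{uV, uE, uA, uQ} V A)

variable [∀ v : V, Fintype (Quiver.Star v)]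

open Classical in
/-- The number of letters `b` sent, along all outgoing edges, when the processor to which the
letter `a` belongs processes `a` in state `q`. -/
noncomputable def sent (a : Letter A) (q : N.Q a.1) (b : Letter A) : ℤ :=
  ∑ e : Quiver.Star a.1,
    ((((N.proc a.1).o a.2 e q).map (Sigma.mk e.1 : A e.1 → Letter A)).count b : ℤ)

open Classical in
/-- Processing one letter `a`: it is removed, the processor to which it belongs changes state,
and the messages are sent. -/
noncomputable def step (a : Letter A) (s : N.TotalState) : N.TotalState :=
  (s.1 - Pi.single a 1 + N.sent a (s.2 a.1),
    Function.update s.2 a.1 ((N.proc a.1).t a.2 (s.2 a.1)))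

/-- The result `π_w(x.q)` of executing the word `w`. -/
noncomputable def exec : List (Letter A) → N.TotalState → N.TotalState
  | [], s => s
  | a :: w, s => exec w (N.step a s)

/-- The word `w` is a legal execution: each letter is present when it is processed. -/
def IsLegal : List (Letter A) → N.TotalState → Prop
  | [], _ => True
  | a :: w, s => 1 ≤ s.1 a ∧ IsLegal w (N.step a s)

/-- The word `w` is a complete execution: no letters remain. -/
def IsComplete (w : List (Letter A)) (s : N.TotalState) : Prop := (N.exec w s).1 ≤ 0

/-- Every `x.q` with `x ≥ 0` has a complete legal execution. -/
def HaltsOnAllInputs : Prop :=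
  ∀ (x : Letter A → ℕ) (q : N.State),
    ∃ w, N.IsLegal w (fun a => (x a : ℤ), q) ∧ N.IsComplete w (fun a => (x a : ℤ), q)

/-! The order of execution does not matter. -/

theorem sent_nonneg (a : Letter A) (q : N.Q a.1) : 0 ≤ N.sent a q := fun _ =>
  Finset.sum_nonneg fun _ _ => Int.natCast_nonneg _

theorem sent_comm (v : V) (a b : A v) (q : N.Q v) :
    N.sent ⟨v, a⟩ q + N.sent ⟨v, b⟩ ((N.proc v).t a q) =
      N.sent ⟨v, b⟩ q + N.sent ⟨v, a⟩ ((N.proc v).t b q) := by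
  classical
  funext c
  simp only [sent, Pi.add_apply, ← Finset.sum_add_distrib]
  refine Finset.sum_congr rfl fun e _ => ?_
  have h := (N.proc v).o_perm [a, b] [b, a] (List.Perm.swap _ _ _) e q
  simp only [outputWord, List.append_nil] at h
  have := (h.map (Sigma.mk e.1 : A e.1 → Letter A)).count_eq c
  simp only [List.map_append, List.count_append] at this
  exact_mod_cast this

theorem step_comm (a b : Letter A) (s : N.TotalState) :
    N.step a (N.step b s) = N.step b (N.step a s) := by
  classical
  obtain ⟨x, q⟩ := s
  obtain ⟨v, a⟩ := a
  obtain ⟨u, b⟩ := b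
  by_cases h : u = v
  · subst h
    refine Prod.ext ?_ ?_
    · have := N.sent_comm u a b (q u)
      simp only [step, Function.update_self]
      calc _ = x - Pi.single ⟨u, b⟩ 1 - Pi.single ⟨u, a⟩ 1 +
            (N.sent ⟨u, b⟩ (q u) + N.sent ⟨u, a⟩ ((N.proc u).t b (q u))) := by abel
        _ = _ := by rw [← this]; abel
    · simp only [step, Function.update_self, Function.update_idem]
      congr 1
      exact congrFun ((N.proc u).t_comm a b) (q u)
  · refine Prod.ext ?_ ?_
    · simp only [step, Function.update_of_ne h, Function.update_of_ne (Ne.symm h)]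
      abel
    · simp only [step, Function.update_of_ne h, Function.update_of_ne (Ne.symm h)]
      exact Function.update_comm h _ _ _

theorem exec_perm {w w' : List (Letter A)} (h : w.Perm w') (s : N.TotalState) :
    N.exec w s = N.exec w' s := by
  induction h generalizing s with
  | nil => rfl
  | cons a _ ih => exact ih _
  | swap a b l => simp only [exec, step_comm]
  | trans _ _ ih₁ ih₂ => exact (ih₁ s).trans (ih₂ s)

theorem exec_append (w w' : List (Letter A)) (s : N.TotalState) :
    N.exec (w ++ w') s = N.exec w' (N.exec w s) := by
  induction w generalizing s with
  | nil => rfl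
  | cons a w ih => exact ih _

theorem isLegal_append (w w' : List (Letter A)) (s : N.TotalState) :
    N.IsLegal (w ++ w') s ↔ N.IsLegal w s ∧ N.IsLegal w' (N.exec w s) := by
  induction w generalizing s with
  | nil => simp [IsLegal, exec]
  | cons a w ih => simp only [List.cons_append, IsLegal, exec, ih, and_assoc]

theorem exec_shift (w : List (Letter A)) (x y : Letter A → ℤ) (q : N.State) :
    N.exec w (x + y, q) = ((N.exec w (x, q)).1 + y, (N.exec w (x, q)).2) := by
  induction w generalizing x q with
  | nil => rfl
  | cons a w ih =>
    simp only [exec, step]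
    rw [← ih]
    congr 2
    abel

theorem IsLegal.shift {w : List (Letter A)} {x y : Letter A → ℤ} {q : N.State} (hy : 0 ≤ y)
    (h : N.IsLegal w (x, q)) : N.IsLegal w (x + y, q) := by
  induction w generalizing x q with
  | nil => trivial
  | cons a w ih =>
    refine ⟨?_, ?_⟩
    · have h1 : 1 ≤ x a := h.1
      have h2 := hy a
      simp only [Pi.zero_apply] at h2
      change 1 ≤ x a + y a
      omega
    · have := ih h.2
      simp only [step] at this ⊢
      convert this using 2
      abel

theorem exec_nonneg {w : List (Letter A)} {s : N.TotalState} (hs : 0 ≤ s.1)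
    (h : N.IsLegal w s) : 0 ≤ (N.exec w s).1 := by
  classical
  induction w generalizing s with
  | nil => exact hs
  | cons a w ih =>
    refine ih ?_ h.2
    intro b
    have h1 := N.sent_nonneg a (s.2 a.1) b
    have h2 := hs b
    have h3 := h.1
    simp only [step, Pi.add_apply, Pi.sub_apply, Pi.zero_apply, Pi.single_apply] at *
    split_ifs with hb
    · subst hb; omega
    · omega

theorem le_exec_of_notMem {w : List (Letter A)} {a : Letter A} (ha : a ∉ w) (s : N.TotalState) :
    s.1 a ≤ (N.exec w s).1 a := by
  classical
  induction w generalizing s with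
  | nil => exact le_rfl
  | cons b w ih =>
    simp only [List.mem_cons, not_or] at ha
    refine le_trans ?_ (ih ha.2 _)
    have h1 := N.sent_nonneg b (s.2 b.1) a
    simp only [step, Pi.add_apply, Pi.sub_apply, Pi.zero_apply, Pi.single_apply, if_neg ha.1] at *
    omega

/-- The least action principle. -/
theorem IsLegal.subperm {w w' : List (Letter A)} {s : N.TotalState} (h : N.IsLegal w s)
    (h' : N.IsComplete w' s) : w.Subperm w' := by
  classical
  induction w generalizing w' s with
  | nil => exact List.nil_subperm
  | cons a w ih =>
    have ha : a ∈ w' := by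
      by_contra hn
      have h1 := N.le_exec_of_notMem hn s
      have h2 := h' a
      have h3 := h.1
      simp only [Pi.zero_apply] at h2
      omega
    have hp := List.perm_cons_erase ha
    have : N.IsComplete (w'.erase a) (N.step a s) := by
      have h2 : N.IsComplete w' s := h'
      rw [IsComplete, N.exec_perm hp] at h2
      exact h2
    exact (List.subperm_cons a |>.2 (ih h.2 this)).trans hp.symm.subperm

theorem exec_unique {w w' : List (Letter A)} {s : N.TotalState} (h : N.IsLegal w s)
    (hc : N.IsComplete w s) (h' : N.IsLegal w' s) (hc' : N.IsComplete w' s) :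
    N.exec w s = N.exec w' s :=
  N.exec_perm ((h.subperm N hc').antisymm (h'.subperm N hc)) s

/-! ### The global action and the critical group -/

variable {N}

/-- The global action `x ▷▷ q`: the final state of a complete legal execution of `x.q`. -/
noncomputable def globalAct (h : N.HaltsOnAllInputs) (x : Letter A → ℕ) (q : N.State) : N.State :=
  (N.exec (h x q).choose (fun a => (x a : ℤ), q)).2

theorem globalAct_eq (h : N.HaltsOnAllInputs) {x : Letter A → ℕ} {q : N.State}
    {w : List (Letter A)} (hl : N.IsLegal w (fun a => (x a : ℤ), q))
    (hc : N.IsComplete w (fun a => (x a : ℤ), q)) :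
    globalAct h x q = (N.exec w (fun a => (x a : ℤ), q)).2 := by
  rw [globalAct, N.exec_unique (h x q).choose_spec.1 (h x q).choose_spec.2 hl hc]

theorem globalAct_add (h : N.HaltsOnAllInputs) (x y : Letter A → ℕ) (q : N.State) :
    globalAct h (x + y) q = globalAct h y (globalAct h x q) := by
  obtain ⟨w, hl, hc⟩ := h x q
  obtain ⟨w', hl', hc'⟩ := h y (globalAct h x q)
  have e1 : (fun a => (((x + y) a : ℕ) : ℤ)) = (fun a => (x a : ℤ)) + fun a => (y a : ℤ) := by
    funext a; simp
  have e2 : (N.exec w (fun a => (x a : ℤ), q)).1 = 0 :=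
    le_antisymm hc (N.exec_nonneg (fun a => Int.natCast_nonneg _) hl)
  have e3 : N.exec w (fun a => (((x + y) a : ℕ) : ℤ), q) =
      (fun a => (y a : ℤ), globalAct h x q) := by
    rw [e1, exec_shift, e2, zero_add, globalAct_eq h hl hc]
  have hl2 : N.IsLegal (w ++ w') (fun a => (((x + y) a : ℕ) : ℤ), q) := by
    rw [isLegal_append, e3]
    refine ⟨?_, hl'⟩
    rw [e1]
    exact hl.shift N (fun a => Int.natCast_nonneg _)
  have hc2 : N.IsComplete (w ++ w') (fun a => (((x + y) a : ℕ) : ℤ), q) := by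
    rw [IsComplete, exec_append, e3]
    exact hc'
  rw [globalAct_eq h hl2 hc2, exec_append, e3, globalAct_eq h hl' hc']

open Classical in
/-- A network that halts on all inputs, viewed as a single abelian processor whose input alphabet
is the total alphabet: the transition maps are `τ_a(q) = 1_a ▷▷ q`. -/
noncomputable def globalProcessor (h : N.HaltsOnAllInputs) :
    AbelianProcessor (Letter A) N.State where
  t a := fun q => globalAct h (Pi.single a 1) q
  t_comm a b := by
    funext q
    change globalAct h _ (globalAct h _ q) = globalAct h _ (globalAct h _ q)
    rw [← globalAct_add, ← globalAct_add, add_comm]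

/-- The critical group `eM`, where `M` is the global monoid, generated by the maps `τ_a`, and `e`
is its minimal idempotent; for a finite network it is a finite abelian group. -/
abbrev Crit (h : N.HaltsOnAllInputs) : Type _ := (globalProcessor h).Grp

/-! ### Irreducibility, total kernel, production map, homotopy -/

variable (N)

/-- Each processor is irreducible. -/
def Irreducible : Prop := ∀ v, (N.proc v).toAbelianProcessor.Irreducible

/-- Locally recurrent states: `q v ∈ e_v Q_v` for all `v`, where `e_v` is the minimal idempotent
of the transition monoid at `v`. -/
abbrev LocRec : Type _ := ∀ v, (N.proc v).toAbelianProcessor.Rec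

variable {N} in
/-- A locally recurrent state as a state of the network. -/
def LocRec.state (p : N.LocRec) : N.State := fun v => (p v).1

/-- The total kernel `K = ∏ K_v`, where `K_v` is the kernel of the action of `ℤ ^ A_v` on
`e_v Q_v`, as a subgroup of `ℤ ^ A` for the total alphabet `A`. -/
noncomputable def totalKernel [∀ v, Finite (N.Q v)] [∀ v, Fintype (A v)] :
    AddSubgroup (Letter A → ℤ) where
  carrier := {x | ∀ v, (fun a => x ⟨v, a⟩) ∈ (N.proc v).toAbelianProcessor.kernel}
  zero_mem' _ := AddSubgroup.zero_mem _
  add_mem' hx hy v := AddSubgroup.add_mem _ (hx v) (hy v)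
  neg_mem' hx v := AddSubgroup.neg_mem _ (hx v)

section LocalAction

variable [Fintype V] [∀ v, Fintype (A v)]

/-- A word in which each letter `a` occurs `x a` times. -/
noncomputable def wordOf (x : Letter A → ℕ) : List (Letter A) :=
  (∑ a, Multiset.replicate (x a) a).toList

open Classical in
theorem count_wordOf (x : Letter A → ℕ) (a : Letter A) : (wordOf x).count a = x a := by
  rw [← Multiset.coe_count, wordOf, Multiset.coe_toList, Multiset.count_sum']
  simp [Multiset.count_replicate]

/-- The local action `x ▷ (y.q) = π_x((x + y).q)`. -/
noncomputable def localAct (x : Letter A → ℕ) (s : N.TotalState) : N.TotalState :=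
  N.exec (wordOf x) ((fun a => (x a : ℤ)) + s.1, s.2)

open Classical in
theorem wordOf_add (x y : Letter A → ℕ) : (wordOf (x + y)).Perm (wordOf x ++ wordOf y) := by
  rw [List.perm_iff_count]
  intro a
  rw [List.count_append, count_wordOf, count_wordOf, count_wordOf, Pi.add_apply]

variable [∀ v, Finite (N.Q v)]

open Classical in
theorem exec_state (w : List (Letter A)) (x : Letter A → ℤ) (p : N.LocRec) :
    (N.exec w (x, p.state)).2 =
      LocRec.state (N := N) (fun v =>
        (N.proc v).toAbelianProcessor.grpElt (fun a => (w.count ⟨v, a⟩ : ℤ)) • p v) := by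
  induction w generalizing x p with
  | nil =>
    have : ∀ v, (fun a : A v => (([] : List (Letter A)).count ⟨v, a⟩ : ℤ)) = 0 := by
      intro v; funext a; simp
    simp only [exec, this, AbelianProcessor.grpElt_zero, one_smul]
  | cons b w ih =>
    obtain ⟨u, b⟩ := b
    have hs : (N.step ⟨u, b⟩ (x, p.state)).2 = LocRec.state (N := N)
        (Function.update p u (MinIdeal.of ((N.proc u).toAbelianProcessor.gen b) • p u)) := by
      funext v
      by_cases h : v = u
      · subst h
        simp only [step, LocRec.state, Function.update_self, RecElts.of_smul]
        rfl
      · simp only [step, LocRec.state, Function.update_of_ne h]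
    have he : N.step ⟨u, b⟩ (x, p.state) = ((N.step ⟨u, b⟩ (x, p.state)).1, LocRec.state (N := N)
        (Function.update p u (MinIdeal.of ((N.proc u).toAbelianProcessor.gen b) • p u))) :=
      Prod.ext rfl hs
    rw [exec, he, ih]
    congr 1
    funext v
    by_cases h : v = u
    · subst h
      rw [Function.update_self, smul_smul, ← AbelianProcessor.grpElt_single,
        ← AbelianProcessor.grpElt_add]
      congr 2
      funext a
      by_cases hab : a = b
      · subst hab; simp
      · have : (⟨v, b⟩ : Letter A) ≠ ⟨v, a⟩ := by
          intro h; exact hab (by simpa using h.symm)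
        simp [hab, List.count_cons_of_ne this]
    · rw [Function.update_of_ne h]
      congr 2
      funext a
      have : (⟨u, b⟩ : Letter A) ≠ ⟨v, a⟩ := by
        intro h'; exact h (congrArg Sigma.fst h').symm
      rw [List.count_cons_of_ne this]

/-- The vector `P_p(k)`, the letters that are sent when the locally recurrent state `p` processes
`k a` letters `a` for each `a`; it is used for `k ∈ K`, so that `k ▷ p = P_p(k).p`. -/
noncomputable def productionNat (p : N.LocRec) (k : Letter A → ℕ) : Letter A → ℤ :=
  (N.localAct k (0, p.state)).1

theorem localAct_eq (p : N.LocRec) {k : Letter A → ℕ} (hk : (fun a => (k a : ℤ)) ∈ N.totalKernel) :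
    N.localAct k (0, p.state) = (N.productionNat p k, p.state) := by
  classical
  refine Prod.ext rfl ?_
  rw [localAct, exec_state]
  congr 1
  funext v
  simp only [count_wordOf]
  exact hk v (p v)

theorem productionNat_add (p : N.LocRec) {k l : Letter A → ℕ}
    (hk : (fun a => (k a : ℤ)) ∈ N.totalKernel) :
    N.productionNat p (k + l) = N.productionNat p k + N.productionNat p l := by
  have h1 := N.localAct_eq p hk
  have e1 : (fun a => (((k + l) a : ℕ) : ℤ)) + 0 = ((fun a => (k a : ℤ)) + 0) +
      ((fun a => (l a : ℤ)) + 0) := by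
    funext a; simp
  rw [productionNat, localAct, N.exec_perm (wordOf_add k l), exec_append]
  simp only [localAct] at h1
  dsimp only
  rw [e1, exec_shift, h1]
  dsimp only
  rw [add_comm, exec_shift, add_comm]
  rfl

/-- A nonnegative vector of the total kernel that is at least `-k`. -/
noncomputable def kernelShift (k : Letter A → ℤ) : Letter A → ℕ :=
  fun a => Nat.card (N.proc a.1).toAbelianProcessor.Grp * (k a).natAbs

theorem kernelShift_mem (k : Letter A → ℤ) :
    (fun a => (N.kernelShift k a : ℤ)) ∈ N.totalKernel := by
  intro v q
  have : (N.proc v).toAbelianProcessor.grpElt (fun a => (N.kernelShift k ⟨v, a⟩ : ℤ)) = 1 := by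
    refine Finset.prod_eq_one fun a _ => ?_
    rw [zpow_natCast]
    change _ ^ (Nat.card (N.proc v).toAbelianProcessor.Grp * _) = 1
    rw [pow_mul, pow_card_eq_one', one_pow]
  rw [this, one_smul]

theorem add_kernelShift_nonneg (k : Letter A → ℤ) (a : Letter A) :
    0 ≤ k a + N.kernelShift k a := by
  have h1 : 1 ≤ Nat.card (N.proc a.1).toAbelianProcessor.Grp := Nat.card_pos
  have h2 : (k a).natAbs ≤ N.kernelShift k a := Nat.le_mul_of_pos_left _ h1
  omega

theorem toNat_kernelShift_mem {k : Letter A → ℤ} (hk : k ∈ N.totalKernel) :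
    (fun a => ((k a + N.kernelShift k a).toNat : ℤ)) ∈ N.totalKernel := by
  have : (fun a => ((k a + N.kernelShift k a).toNat : ℤ)) =
      k + fun a => (N.kernelShift k a : ℤ) := by
    funext a
    simp [Int.toNat_of_nonneg (N.add_kernelShift_nonneg k a)]
  rw [this]
  exact AddSubgroup.add_mem _ hk (N.kernelShift_mem k)

theorem productionNat_sub (p : N.LocRec) {k l k' l' : Letter A → ℕ}
    (hk : (fun a => (k a : ℤ)) ∈ N.totalKernel) (hk' : (fun a => (k' a : ℤ)) ∈ N.totalKernel)
    (h : ∀ a, (k a : ℤ) - l a = k' a - l' a) :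
    N.productionNat p k - N.productionNat p l = N.productionNat p k' - N.productionNat p l' := by
  have e : k + l' = k' + l := by
    funext a
    have := h a
    simp only [Pi.add_apply]
    omega
  have := congrArg (N.productionNat p) e
  rw [N.productionNat_add p hk, N.productionNat_add p hk'] at this
  rw [sub_eq_sub_iff_add_eq_add, this]

/-- The extension of `P_p` to a group homomorphism from the total kernel `K` to `ℤ ^ A`. -/
noncomputable def productionAt (p : N.LocRec) : N.totalKernel →+ (Letter A → ℤ) :=
  AddMonoidHom.mk'
    (fun k => N.productionNat p (fun a => (k.1 a + N.kernelShift k.1 a).toNat) -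
      N.productionNat p (N.kernelShift k.1))
    (by
      intro k l
      have h3 := N.productionNat_add p (l := fun a => (l.1 a + N.kernelShift l.1 a).toNat)
        (N.toNat_kernelShift_mem k.2)
      have h4 := N.productionNat_add p (l := N.kernelShift l.1) (N.kernelShift_mem k.1)
      rw [sub_add_sub_comm, ← h3, ← h4]
      refine N.productionNat_sub p (N.toNat_kernelShift_mem (k + l).2) ?_ ?_
      · exact AddSubgroup.add_mem _ (N.toNat_kernelShift_mem k.2) (N.toNat_kernelShift_mem l.2)
      · intro a
        have a1 := N.add_kernelShift_nonneg k.1 a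
        have a2 := N.add_kernelShift_nonneg l.1 a
        have a3 := N.add_kernelShift_nonneg (k + l).1 a
        have a4 : (k + l).1 a = k.1 a + l.1 a := rfl
        simp only [Pi.add_apply]
        rw [Int.toNat_of_nonneg a3, Nat.cast_add, Nat.cast_add, Int.toNat_of_nonneg a1,
          Int.toNat_of_nonneg a2, a4]
        ring)

/-- On the nonnegative vectors of `K` the homomorphism is `P_p`. -/
theorem productionAt_nat (p : N.LocRec) (k : Letter A → ℕ)
    (hk : (fun a => (k a : ℤ)) ∈ N.totalKernel) :
    N.productionAt p ⟨_, hk⟩ = N.productionNat p k := by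
  have h0 : N.productionNat p 0 = 0 := by
    simpa using N.productionNat_add p (k := 0) (l := 0) (AddSubgroup.zero_mem _)
  rw [← sub_zero (N.productionNat p k), ← h0]
  refine N.productionNat_sub p (N.toNat_kernelShift_mem hk) hk ?_
  intro a
  have := N.add_kernelShift_nonneg (fun a => (k a : ℤ)) a
  rw [Int.toNat_of_nonneg this]
  simp

variable {N}

theorem LocRec.nonempty (h : N.Irreducible) : Nonempty N.LocRec :=
  ⟨fun v => ⟨minIdem _ • (h v).1.some, _, rfl⟩⟩

/-- The production map `P : K → ℤ ^ A` of an irreducible network. The locally recurrent state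
that is used is immaterial, see `productionMap_eq`. -/
noncomputable def productionMap (h : N.Irreducible) : N.totalKernel →+ (Letter A → ℤ) :=
  N.productionAt (LocRec.nonempty h).some

open Classical in
theorem productionNat_update_gen (p : N.LocRec) {k : Letter A → ℕ}
    (hk : (fun a => (k a : ℤ)) ∈ N.totalKernel) (v : V) (a : A v) :
    N.productionNat
      (Function.update p v (MinIdeal.of ((N.proc v).toAbelianProcessor.gen a) • p v)) k =
      N.productionNat p k := by
  set p' : N.LocRec :=
    Function.update p v (MinIdeal.of ((N.proc v).toAbelianProcessor.gen a) • p v) with hp'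
  have hs : (N.step ⟨v, a⟩ (0, p.state)).2 = p'.state := by
    funext u
    by_cases h : u = v
    · subst h
      simp only [hp', step, LocRec.state, Function.update_self, RecElts.of_smul]
      rfl
    · simp only [hp', step, LocRec.state, Function.update_of_ne h]
  have h1 := N.localAct_eq p hk
  have h2 := N.localAct_eq p' hk
  simp only [localAct, add_zero] at h1 h2
  have h3 : N.exec (wordOf k ++ [⟨v, a⟩]) (fun a => (k a : ℤ), p.state) =
      N.exec ([⟨v, a⟩] ++ wordOf k) (fun a => (k a : ℤ), p.state) :=
    N.exec_perm List.perm_append_comm _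
  rw [exec_append, exec_append, h1] at h3
  have e1 : ∀ y : Letter A → ℤ, N.exec [⟨v, a⟩] (y, p.state) =
      (y + (N.step ⟨v, a⟩ (0, p.state)).1, p'.state) := by
    intro y
    have := N.exec_shift [⟨v, a⟩] 0 y p.state
    rw [zero_add] at this
    rw [this]
    simp only [exec, hs, add_comm]
  rw [e1, e1, exec_shift, h2] at h3
  have h4 := congrArg Prod.fst h3
  dsimp only at h4
  exact (add_right_cancel h4).symm

open Classical in
theorem productionNat_update_of (p : N.LocRec) {k : Letter A → ℕ}
    (hk : (fun a => (k a : ℤ)) ∈ N.totalKernel) (v : V)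
    (m : (N.proc v).toAbelianProcessor.transitionMonoid) :
    N.productionNat (Function.update p v (MinIdeal.of m • p v)) k = N.productionNat p k := by
  obtain ⟨m, hm⟩ := m
  induction hm using Submonoid.closure_induction generalizing p with
  | mem f hf =>
    obtain ⟨a, rfl⟩ := hf
    exact productionNat_update_gen p hk v a
  | one =>
    have : MinIdeal.of (⟨1, Submonoid.one_mem _⟩ :
        (N.proc v).toAbelianProcessor.transitionMonoid) • p v = p v :=
      Subtype.ext (RecElts.of_smul _ _)
    rw [this, Function.update_eq_self]
  | mul f g hf hg ihf ihg =>
    have h1 := ihg p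
    have h2 := ihf (Function.update p v (MinIdeal.of
      (⟨g, hg⟩ : (N.proc v).toAbelianProcessor.transitionMonoid) • p v))
    rw [Function.update_self, Function.update_idem, h1] at h2
    rw [← h2]
    congr 2
    refine Subtype.ext ?_
    rw [RecElts.of_smul, RecElts.of_smul, RecElts.of_smul]
    rfl

theorem productionNat_eq (h : N.Irreducible) (p p' : N.LocRec) {k : Letter A → ℕ}
    (hk : (fun a => (k a : ℤ)) ∈ N.totalKernel) :
    N.productionNat p k = N.productionNat p' k := by
  classical
  have key : ∀ (p : N.LocRec) v x, N.productionNat (Function.update p v x) k =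
      N.productionNat p k := by
    intro p v x
    obtain ⟨m, m', hm⟩ := (h v).2 x.1 (p v).1
    have h1 := productionNat_update_of (Function.update p v x) hk v m
    have h2 := productionNat_update_of p hk v m'
    have h3 : MinIdeal.of m • x = MinIdeal.of m' • p v := by
      refine Subtype.ext ?_
      rw [RecElts.of_smul, RecElts.of_smul, hm]
    rw [Function.update_self, Function.update_idem, h3, h2] at h1
    exact h1.symm
  have : ∀ s : Finset V, N.productionNat (s.piecewise p p') k = N.productionNat p' k := by
    intro s
    induction s using Finset.induction_on with
    | empty => rw [Finset.piecewise_empty]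
    | insert v s _ ih => rw [Finset.piecewise_insert, key, ih]
  simpa using this Finset.univ

theorem productionMap_eq (h : N.Irreducible) (p : N.LocRec) :
    productionMap h = N.productionAt p := by
  ext1 k
  simp only [productionMap, productionAt, AddMonoidHom.mk'_apply]
  rw [productionNat_eq h _ p (N.toNat_kernelShift_mem k.2),
    productionNat_eq h _ p (N.kernelShift_mem k.1)]

/-- Two irreducible abelian networks on the same graph with the same total alphabet are homotopic
if they have the same total kernel and the same production map. -/
structure Homotopic (N : AbelianNetwork.{uV, uE, uA, uQ} V A)
    (N' : AbelianNetwork.{uV, uE, uA, uQ'} V A)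
    [∀ v, Finite (N.Q v)] [∀ v, Finite (N'.Q v)] : Prop where
  irreducible : N.Irreducible
  irreducible' : N'.Irreducible
  kernel_eq : N.totalKernel = N'.totalKernel
  production_eq : ∀ k (hk : k ∈ N.totalKernel) (hk' : k ∈ N'.totalKernel),
    productionMap irreducible ⟨k, hk⟩ = productionMap irreducible' ⟨k, hk'⟩

end LocalAction

end AbelianNetwork

/-! ### Sandpile and rotor networks -/

section Examples

variable {V : Type uV} [Quiver.{uE + 1} V]

/-- From every other vertex there is a directed path to `s`. -/
class IsGlobalSink (s : V) : Prop where
  reach : ∀ v, v ≠ s → Nonempty (Quiver.Path v s)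

variable [∀ v : V, Fintype (Quiver.Star v)]

/-- The outdegree `d_v`, counting multiple edges and loops. -/
def outdegree (v : V) : ℕ := Fintype.card (Quiver.Star v)

open Classical in
/-- The threshold of `v`: the outdegree if `v ≠ s`, and `1` for the sink `s`. -/
noncomputable def threshold (s v : V) : ℕ := if v = s then 1 else outdegree v

theorem nonempty_star_of_path {v s : V} (p : Quiver.Path v s) (h : v ≠ s) :
    Nonempty (Quiver.Star v) := by
  induction p with
  | nil => exact absurd rfl h
  | @cons b c p e ih =>
    by_cases hb : v = b
    · subst hb
      exact ⟨⟨_, e⟩⟩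
    · exact ih hb

instance (s v : V) [hs : IsGlobalSink s] : NeZero (threshold s v) where
  out := by
    unfold threshold
    split_ifs with h
    · exact one_ne_zero
    · obtain ⟨p⟩ := hs.reach v h
      have := nonempty_star_of_path p h
      exact Fintype.card_ne_zero

/-- The processor at `v` with one-letter alphabet, state space `ℤ/r`, transition map `q ↦ q + 1`
and the given messages. -/
def cyclicProcessor {U : Type*} (r : ℕ) (o : U → ZMod r → List Unit) :
    OutputProcessor Unit (ZMod r) (fun _ : U => Unit) where
  t _ := fun q => q + 1
  t_comm _ _ := rfl
  o _ := o
  o_perm w w' h u q := by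
    have : w = w' := List.ext_getElem h.length_eq fun _ _ _ => rfl
    rw [this]

open Classical in
/-- The sandpile network with sink `s`; the letter of the alphabet at `v` is called `()`.
When the processor at `v ≠ s` moves from state `d_v - 1` to state `0`, it sends one letter along
each outgoing edge; the sink has one state and sends nothing. -/
noncomputable def sand (s : V) : AbelianNetwork.{uV, uE, 0, 0} V (fun _ => Unit) where
  Q v := ZMod (threshold s v)
  proc v := cyclicProcessor (threshold s v)
    (fun _ q => if v ≠ s ∧ q + 1 = 0 then [()] else [])

open Classical in
/-- The rotor network with sink `s`, where `ord v` is an ordering of the outgoing edges of `v`.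
When the processor at `v ≠ s` moves from state `q` to state `q + 1`, it sends one letter along
the edge in position `q` (positions are numbered from `0`); the sink has one state and sends
nothing. -/
noncomputable def rotor (s : V) (ord : ∀ v : V, Quiver.Star v ≃ Fin (outdegree v)) :
    AbelianNetwork.{uV, uE, 0, 0} V (fun _ => Unit) where
  Q v := ZMod (threshold s v)
  proc v := cyclicProcessor (threshold s v)
    (fun e q => if v ≠ s ∧ q.val = (ord v e : ℕ) then [()] else [])

instance (s : V) [IsGlobalSink s] (v : V) : Finite ((sand s).Q v) :=
  inferInstanceAs (Finite (ZMod (threshold s v)))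

instance (s : V) [IsGlobalSink s] (ord : ∀ v : V, Quiver.Star v ≃ Fin (outdegree v)) (v : V) :
    Finite ((rotor s ord).Q v) :=
  inferInstanceAs (Finite (ZMod (threshold s v)))

end Examples

/-! ### The map from a finite commutative monoid to its group `eM` -/

/-! Everything rests on the presentation `Crit N ≃ ℤ ^ A / (I - P) K`: only the total kernel and the
production map enter it, so homotopic networks share it. The homomorphism `ℤ ^ A → Crit N`, `1_a ↦ e
τ_a`, is onto because the `τ_a` generate the global monoid; the substance is
`grpElt_globalProcessor_eq_one_iff`, which computes its kernel.

The kernel contains `(I - P) K`: states in `eQ` are locally recurrent, and from such a state a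
nonnegative `k ∈ K` can be processed legally, which restores the state and leaves the letters `P k`.
So the inputs `k` and `P k` act alike on `eQ`, and every element of `K` is a difference of
nonnegative ones. Conversely, let `y - z` be in the kernel with `y, z ≥ 0`. Complete legal
executions of `y` and `z` from one state in `eQ` end in the same state. By irreducibility their
letter counts differ by some `k ∈ K`, and comparing the letters sent gives `P k = k - (y - z)`.

The sandpile and rotor networks have the same cyclic processors up to the messages. Their total
kernel is generated by the vectors `r_v 1_v`, where `r_v` is the period, and `P` sends such a vector
to what `v` sends in a full cycle: in both networks one letter along each outgoing edge, or nothing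
if `v = s`. Both halt because letters can be given positive weights that drop, on average over the
outgoing edges, at every vertex other than the sink. -/

namespace MinIdeal

variable {M : Type*} [CommMonoid M] [Finite M]

variable (M) in
/-- The homomorphism `m ↦ em` from `M` to `eM`. -/
noncomputable def ofHom : M →* MinIdeal M where
  toFun := of
  map_one' := Subtype.ext (mul_one _)
  map_mul' m n := Subtype.ext (by
    change minIdem M * (m * n) = minIdem M * m * (minIdem M * n)
    rw [mul_mul_mul_comm, minIdem_idem.eq])

theorem ofHom_apply (m : M) : ofHom M m = of m := rfl

theorem of_val (g : MinIdeal M) : of g.1 = g := Subtype.ext (minIdem_mul_val g)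

end MinIdeal

/-! ### The homomorphism from `ℤ ^ I` to the group of a processor -/

namespace AbelianProcessor

variable {I Q : Type*} (P : AbelianProcessor I Q) [Finite Q] [Fintype I]

theorem grpElt_natCast (x : I → ℕ) :
    P.grpElt (fun a => (x a : ℤ)) = MinIdeal.of (∏ a, P.gen a ^ x a) := by
  rw [← MinIdeal.ofHom_apply, map_prod]
  simp only [map_pow, grpElt, zpow_natCast, MinIdeal.ofHom_apply]

/-- The homomorphism `ℤ ^ I → eM`, in multiplicative notation. -/
noncomputable def grpHom : Multiplicative (I → ℤ) →* P.Grp where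
  toFun x := P.grpElt x.toAdd
  map_one' := P.grpElt_zero
  map_mul' x y := P.grpElt_add x.toAdd y.toAdd

/-- The range is a subgroup containing the images of the generators `t a`, so induction over the
generated submonoid suffices. -/
theorem of_mem_range_grpHom (m : P.transitionMonoid) : MinIdeal.of m ∈ P.grpHom.range := by
  classical
  obtain ⟨m, hm⟩ := m
  induction hm using Submonoid.closure_induction with
  | mem f hf =>
    obtain ⟨a, rfl⟩ := hf
    exact ⟨Multiplicative.ofAdd (Pi.single a 1), P.grpElt_single a⟩
  | one =>
    have := Subgroup.one_mem P.grpHom.range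
    rw [← map_one (MinIdeal.ofHom P.transitionMonoid)] at this
    exact this
  | mul f g hf hg ihf ihg =>
    have := map_mul (MinIdeal.ofHom P.transitionMonoid) ⟨f, hf⟩ ⟨g, hg⟩
    simp only [MinIdeal.ofHom_apply] at this
    have h2 := Subgroup.mul_mem _ ihf ihg
    rw [← this] at h2
    exact h2

theorem grpHom_surjective : Function.Surjective P.grpHom := fun g => by
  rw [← MinIdeal.of_val g]
  exact P.of_mem_range_grpHom g.1

/-- Two processors with the same input alphabet whose maps `ℤ ^ I → eM` have the same kernel
have isomorphic groups. -/
theorem nonempty_grp_mulEquiv {Q' : Type*} [Finite Q'] (P' : AbelianProcessor I Q')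
    (h : ∀ x, P.grpElt x = 1 ↔ P'.grpElt x = 1) : Nonempty (P.Grp ≃* P'.Grp) := by
  have hk : P.grpHom.ker = P'.grpHom.ker := by
    ext x
    exact h x.toAdd
  -- Both groups are quotients of `ℤ ^ I`, by the same subgroup.
  exact ⟨(QuotientGroup.quotientKerEquivOfSurjective _ P.grpHom_surjective).symm.trans
    ((QuotientGroup.quotientMulEquivOfEq hk).trans
      (QuotientGroup.quotientKerEquivOfSurjective _ P'.grpHom_surjective))⟩

/-- In an irreducible processor, a vector that fixes one recurrent state fixes all of them. -/
theorem mem_kernel_of_smul_eq (hP : P.Irreducible) {x : I → ℤ} (q : P.Rec)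
    (hx : P.grpElt x • q = q) : x ∈ P.kernel := by
  intro q'
  obtain ⟨m, m', hm⟩ := hP.2 q.1 q'.1
  have h3 : MinIdeal.of m • q = MinIdeal.of m' • q' := by
    refine Subtype.ext ?_
    rw [RecElts.of_smul, RecElts.of_smul, hm]
  -- Irreducibility makes the group action transitive on recurrent states; as the group is
  -- commutative, all stabilizers coincide.
  have h4 : q' = ((MinIdeal.of m')⁻¹ * MinIdeal.of m) • q := by
    rw [mul_smul, h3, smul_smul, inv_mul_cancel, one_smul]
  rw [h4, smul_smul, mul_comm, mul_smul, hx]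

end AbelianProcessor

namespace AbelianNetwork

variable {V : Type uV} [Quiver.{uE + 1} V] {A : V → Type uA}
variable {N : AbelianNetwork.{uV, uE, uA, uQ} V A} [∀ v : V, Fintype (Quiver.Star v)]

/-! ### Global action -/

open Classical in
theorem isLegal_of_count_le {w : List (Letter A)} {s : N.TotalState}
    (h : ∀ a, (w.count a : ℤ) ≤ s.1 a) : N.IsLegal w s := by
  induction w generalizing s with
  | nil => trivial
  | cons a w ih =>
    refine ⟨?_, ih fun b => ?_⟩
    · have := h a
      rw [List.count_cons_self] at this
      push_cast at this
      omega
    · have h1 := h b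
      have h2 := N.sent_nonneg a (s.2 a.1) b
      simp only [step, Pi.add_apply, Pi.sub_apply, Pi.zero_apply] at *
      by_cases hb : a = b
      · subst hb
        rw [List.count_cons_self] at h1
        push_cast at h1
        rw [Pi.single_eq_same]
        omega
      · rw [List.count_cons_of_ne hb] at h1
        rw [Pi.single_eq_of_ne (Ne.symm hb)]
        omega

theorem globalAct_zero (h : N.HaltsOnAllInputs) (q : N.State) : globalAct h 0 q = q :=
  globalAct_eq h (w := []) trivial (fun a => by simp [exec])

/-- A legal execution may be stopped at any time and continued to a complete one, and the final
state does not depend on the choice. The remaining letters are packaged as natural numbers so that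
`globalAct` applies to them. -/
theorem globalAct_of_isLegal (h : N.HaltsOnAllInputs) {x : Letter A → ℕ} {q : N.State}
    {w : List (Letter A)} (hl : N.IsLegal w (fun a => (x a : ℤ), q)) :
    ∃ y : Letter A → ℕ, N.exec w (fun a => (x a : ℤ), q) =
        (fun a => (y a : ℤ), (N.exec w (fun a => (x a : ℤ), q)).2) ∧
      globalAct h x q = globalAct h y (N.exec w (fun a => (x a : ℤ), q)).2 := by
  have h0 := N.exec_nonneg (fun a => Int.natCast_nonneg _) hl
  set s := N.exec w (fun a => (x a : ℤ), q) with hs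
  have e : s = (fun a => ((s.1 a).toNat : ℤ), s.2) := by
    refine Prod.ext ?_ rfl
    funext a
    exact (Int.toNat_of_nonneg (h0 a)).symm
  refine ⟨fun a => (s.1 a).toNat, e, ?_⟩
  obtain ⟨w', hl', hc'⟩ := h (fun a => (s.1 a).toNat) s.2
  rw [globalAct_eq h hl' hc', globalAct_eq h (w := w ++ w'), exec_append, ← hs, ← e]
  · rw [isLegal_append, ← hs, e]
    exact ⟨hl, hl'⟩
  · rw [IsComplete, exec_append, ← hs, e]
    exact hc'

theorem globalAct_comm (h : N.HaltsOnAllInputs) (x y : Letter A → ℕ) (q : N.State) :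
    globalAct h x (globalAct h y q) = globalAct h y (globalAct h x q) := by
  rw [← globalAct_add, ← globalAct_add, add_comm]

section Finite

variable [Fintype V] [∀ v, Fintype (A v)]

/-- The element of the global monoid that acts as the input `x`. -/
noncomputable def globalElt (h : N.HaltsOnAllInputs) (x : Letter A → ℕ) :
    (globalProcessor h).transitionMonoid :=
  ∏ a, (globalProcessor h).gen a ^ x a

theorem globalElt_smul (h : N.HaltsOnAllInputs) (x : Letter A → ℕ) (q : N.State) :
    globalElt h x • q = globalAct h x q := by
  classical
  have hpow : ∀ a n (q : N.State), (globalProcessor h).gen a ^ n • q =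
      globalAct h (n • Pi.single a 1) q := by
    intro a n
    induction n with
    | zero => intro q; rw [zero_smul, globalAct_zero, pow_zero, one_smul]
    | succ n ih =>
      intro q
      rw [pow_succ, mul_smul, ih, succ_nsmul', globalAct_add]
      congr 2
  have key : ∀ (s : Finset (Letter A)) (q : N.State),
      (∏ a ∈ s, (globalProcessor h).gen a ^ x a) • q =
      globalAct h (∑ a ∈ s, x a • Pi.single a 1) q := by
    intro s
    induction s using Finset.induction_on with
    | empty => intro q; rw [Finset.prod_empty, Finset.sum_empty, globalAct_zero, one_smul]
    | insert a s ha ih =>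
      intro q
      rw [Finset.prod_insert ha, Finset.sum_insert ha, globalAct_add, mul_smul, ih, hpow,
        globalAct_comm]
  rw [globalElt, key]
  congr 1
  funext b
  simp [Finset.sum_apply, Pi.single_apply]

variable [∀ v, Finite (N.Q v)]

/-- A state is locally recurrent at `v` if its component at `v` is recurrent. -/
def IsRecAt (N : AbelianNetwork.{uV, uE, uA, uQ} V A) (v : V) (q : N.State) : Prop :=
  ∃ y, q v = minIdem (N.proc v).toAbelianProcessor.transitionMonoid • y

/-- The transition maps at `v` commute with `e_v`, hence preserve `e_v Q_v`. -/
theorem IsRecAt.exec {v : V} {w : List (Letter A)} {s : N.TotalState} (hs : N.IsRecAt v s.2) :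
    N.IsRecAt v (N.exec w s).2 := by
  classical
  induction w generalizing s with
  | nil => exact hs
  | cons a w ih =>
    refine ih ?_
    obtain ⟨u, a⟩ := a
    by_cases h : v = u
    · subst h
      obtain ⟨y, hy⟩ := hs
      refine ⟨(N.proc v).toAbelianProcessor.gen a • y, ?_⟩
      rw [smul_smul, mul_comm, mul_smul, ← hy]
      simp only [step, Function.update_self]
      rfl
    · unfold IsRecAt
      simp only [step, Function.update_of_ne h]
      exact hs

theorem IsRecAt.globalAct {v : V} {q : N.State} (hq : N.IsRecAt v q) (h : N.HaltsOnAllInputs)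
    (x : Letter A → ℕ) : N.IsRecAt v (globalAct h x q) := by
  obtain ⟨w, hl, hc⟩ := h x q
  rw [globalAct_eq h hl hc]
  exact IsRecAt.exec (s := (fun a => (x a : ℤ), q)) hq

/-- Spell `m` as a product of generators. Legality plays no role: `exec` does not ask whether
letters are present. -/
theorem exists_exec_eq_smul (v : V) (m : (N.proc v).toAbelianProcessor.transitionMonoid) :
    ∃ w : List (Letter A), ∀ s : N.TotalState, (N.exec w s).2 v = m • s.2 v := by
  classical
  obtain ⟨m, hm⟩ := m
  induction hm using Submonoid.closure_induction with
  | mem f hf =>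
    obtain ⟨a, rfl⟩ := hf
    refine ⟨[⟨v, a⟩], fun s => ?_⟩
    simp only [exec, step, Function.update_self]
    rfl
  | one => exact ⟨[], fun s => rfl⟩
  | mul f g hf hg ihf ihg =>
    obtain ⟨wf, hwf⟩ := ihf
    obtain ⟨wg, hwg⟩ := ihg
    refine ⟨wg ++ wf, fun s => ?_⟩
    rw [exec_append, hwf, hwg]
    rfl

/-- Supply in advance all letters of a word that realizes `e_v`. Executing it is then legal and
brings the processor at `v` into `e_v Q_v`, which it does not leave afterwards. -/
theorem exists_globalAct_isRecAt (h : N.HaltsOnAllInputs) (v : V) :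
    ∃ x : Letter A → ℕ, ∀ q, N.IsRecAt v (globalAct h x q) := by
  classical
  obtain ⟨w, hw⟩ := N.exists_exec_eq_smul v (minIdem _)
  refine ⟨fun a => w.count a, fun q => ?_⟩
  obtain ⟨y, -, hy⟩ := globalAct_of_isLegal h (x := fun a => w.count a) (q := q) (w := w)
    (isLegal_of_count_le fun a => by dsimp only; convert le_rfl)
  rw [hy]
  refine IsRecAt.globalAct ⟨_, hw _⟩ h y

theorem exists_locRec_globalAct (h : N.HaltsOnAllInputs) :
    ∃ x : Letter A → ℕ, ∀ q, ∃ p : N.LocRec, globalAct h x q = p.state := by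
  classical
  choose x hx using exists_globalAct_isRecAt (N := N) h
  refine ⟨∑ v, x v, fun q => ?_⟩
  have : ∀ v, N.IsRecAt v (globalAct h (∑ v, x v) q) := by
    intro v
    -- The input `x v` is made to act last; it works from every state.
    rw [← Finset.sum_erase_add _ _ (Finset.mem_univ v), globalAct_add]
    exact hx v _
  exact ⟨fun v => ⟨_, this v⟩, rfl⟩

/-- The minimal idempotent is a multiple of every element, in particular of one whose values are all
locally recurrent. -/
theorem exists_locRec_minIdem_smul (h : N.HaltsOnAllInputs) (q : N.State) :
    ∃ p : N.LocRec, minIdem (globalProcessor h).transitionMonoid • q = p.state := by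
  obtain ⟨x, hx⟩ := exists_locRec_globalAct h
  obtain ⟨m, hm⟩ := dvd_minIdem (globalElt h x)
  obtain ⟨p, hp⟩ := hx (m • q)
  exact ⟨p, by rw [hm, mul_smul, globalElt_smul, hp]⟩

/-- Elements of the global monoid are self-maps of `Q`, so those of the form `e m` are determined by
how `m` acts on `eQ`. This translates identities in `Crit N` into statements about executions. -/
theorem grpElt_globalProcessor_eq_iff (h : N.HaltsOnAllInputs) (x y : Letter A → ℕ) :
    (globalProcessor h).grpElt (fun a => (x a : ℤ)) =
        (globalProcessor h).grpElt (fun a => (y a : ℤ)) ↔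
      ∀ q, globalAct h x (minIdem (globalProcessor h).transitionMonoid • q) =
        globalAct h y (minIdem (globalProcessor h).transitionMonoid • q) := by
  rw [AbelianProcessor.grpElt_natCast, AbelianProcessor.grpElt_natCast]
  change MinIdeal.of (globalElt h x) = MinIdeal.of (globalElt h y) ↔ _
  simp only [← globalElt_smul, smul_smul]
  rw [mul_comm _ (minIdem _), mul_comm _ (minIdem _)]
  constructor
  · intro hxy q
    exact congrArg (· • q) (congrArg Subtype.val hxy)
  · intro hxy
    exact Subtype.ext (Subtype.ext (funext hxy))

/-! ### The kernel of `ℤ ^ A → Crit N` is `(I - P) K` -/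

/-- Processing exactly the letters of `k` is a legal start of the execution; it returns to `p` with
the letters `y` waiting. -/
theorem globalAct_eq_of_mem_totalKernel (h : N.HaltsOnAllInputs) (p : N.LocRec)
    {k y : Letter A → ℕ} (hk : (fun a => (k a : ℤ)) ∈ N.totalKernel)
    (hy : N.productionNat p k = fun a => (y a : ℤ)) :
    globalAct h k p.state = globalAct h y p.state := by
  classical
  have h1 := N.localAct_eq p hk
  simp only [localAct, add_zero] at h1
  obtain ⟨z, hz, hg⟩ := globalAct_of_isLegal h (x := k) (q := p.state) (w := wordOf k)
    (isLegal_of_count_le fun a => by rw [count_wordOf])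
  rw [h1] at hz hg
  rw [hg]
  congr 1
  have h2 := congrArg Prod.fst hz
  rw [hy] at h2
  funext a
  have h3 : (y a : ℤ) = z a := congrFun h2 a
  exact_mod_cast h3.symm

theorem productionNat_nonneg (p : N.LocRec) (k : Letter A → ℕ) : 0 ≤ N.productionNat p k := by
  classical
  refine N.exec_nonneg ?_ (isLegal_of_count_le fun a => ?_)
  · intro a
    simp
  · rw [count_wordOf]
    simp

theorem grpElt_production_of_nat (h : N.HaltsOnAllInputs) (hN : N.Irreducible)
    (k : Letter A → ℕ) (hk : (fun a => (k a : ℤ)) ∈ N.totalKernel) :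
    (globalProcessor h).grpElt (productionMap hN ⟨_, hk⟩) =
      (globalProcessor h).grpElt (fun a => (k a : ℤ)) := by
  obtain ⟨p₀⟩ := LocRec.nonempty hN
  rw [productionMap_eq hN p₀, productionAt_nat]
  have e : N.productionNat p₀ k = fun a => ((N.productionNat p₀ k a).toNat : ℤ) := by
    funext a
    exact (Int.toNat_of_nonneg (productionNat_nonneg p₀ k a)).symm
  rw [e, grpElt_globalProcessor_eq_iff]
  intro q
  obtain ⟨p, hp⟩ := exists_locRec_minIdem_smul h q
  rw [hp]
  -- Irreducibility is needed here: the same vector `P k` must serve for every state in `eQ`.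
  exact (globalAct_eq_of_mem_totalKernel h p hk ((productionNat_eq hN p p₀ hk).trans e)).symm

/-- Adding a large nonnegative element of `K` reduces to the nonnegative case, since both sides are
additive in `k`. -/
theorem grpElt_sub_production (h : N.HaltsOnAllInputs) (hN : N.Irreducible)
    (k : N.totalKernel) :
    (globalProcessor h).grpElt (k.1 - productionMap hN k) = 1 := by
  have e : (⟨_, N.toNat_kernelShift_mem k.2⟩ : N.totalKernel) =
      k + ⟨_, N.kernelShift_mem k.1⟩ :=
    Subtype.ext (funext fun a => Int.toNat_of_nonneg (N.add_kernelShift_nonneg k.1 a))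
  have h1 := grpElt_production_of_nat h hN _ (N.toNat_kernelShift_mem k.2)
  have h2 := grpElt_production_of_nat h hN _ (N.kernelShift_mem k.1)
  have h3 : (globalProcessor h).grpElt k.1 =
      (globalProcessor h).grpElt (productionMap hN k) := by
    have e' : (fun a => ((k.1 a + N.kernelShift k.1 a).toNat : ℤ)) =
        k.1 + fun a => (N.kernelShift k.1 a : ℤ) := congrArg Subtype.val e
    rw [e, map_add, e', AbelianProcessor.grpElt_add, AbelianProcessor.grpElt_add, h2] at h1
    exact (mul_right_cancel h1).symm
  have h4 := (globalProcessor h).grpElt_add (k.1 - productionMap hN k) (productionMap hN k)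
  rw [sub_add_cancel, h3] at h4
  exact (mul_eq_right.mp h4.symm)

theorem exec_wordOf_add (k m : Letter A → ℕ) (x : Letter A → ℤ) (q : N.State) :
    N.exec (wordOf (k + m)) (x, q) = N.exec (wordOf m) (N.exec (wordOf k) (x, q)) := by
  rw [N.exec_perm (wordOf_add k m), exec_append]

open Classical in
theorem exec_wordOf_count (w : List (Letter A)) (s : N.TotalState) :
    N.exec (wordOf fun a => w.count a) s = N.exec w s :=
  N.exec_perm (List.perm_iff_count.2 fun a => count_wordOf _ a) s

theorem exec_fst_sub (w : List (Letter A)) (x y : Letter A → ℤ) (q : N.State) :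
    (N.exec w (x, q)).1 - (N.exec w (y, q)).1 = x - y := by
  have := N.exec_shift w y (x - y) q
  rw [add_sub_cancel] at this
  rw [this]
  simp

/-- The witness is the difference of the letter counts of complete executions for the positive and
the negative part of `x`, started in a common state of `eQ`. -/
theorem exists_eq_sub_production (h : N.HaltsOnAllInputs) (hN : N.Irreducible)
    {x : Letter A → ℤ} (hx : (globalProcessor h).grpElt x = 1) :
    ∃ k : N.totalKernel, x = k.1 - productionMap hN k := by
  classical
  set y : Letter A → ℕ := fun a => (x a).toNat with hy
  set z : Letter A → ℕ := fun a => (-x a).toNat with hz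
  have hxyz : x = (fun a => (y a : ℤ)) - fun a => (z a : ℤ) := by
    funext a
    simp only [hy, hz, Pi.sub_apply]
    omega
  have hyz : (globalProcessor h).grpElt (fun a => (y a : ℤ)) =
      (globalProcessor h).grpElt (fun a => (z a : ℤ)) := by
    have := (globalProcessor h).grpElt_add x (fun a => (z a : ℤ))
    rwa [hx, one_mul, hxyz, sub_add_cancel] at this
  rw [grpElt_globalProcessor_eq_iff] at hyz
  obtain ⟨p, hp⟩ := exists_locRec_minIdem_smul h fun v => (hN v).1.some
  have hyz := hyz fun v => (hN v).1.some
  rw [hp] at hyz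
  obtain ⟨w, hl, hc⟩ := h y p.state
  obtain ⟨w', hl', hc'⟩ := h z p.state
  rw [globalAct_eq h hl hc, globalAct_eq h hl' hc'] at hyz
  have e1 : (N.exec w (fun a => (y a : ℤ), p.state)).1 = 0 :=
    le_antisymm hc (N.exec_nonneg (fun a => Int.natCast_nonneg _) hl)
  have e2 : (N.exec w' (fun a => (z a : ℤ), p.state)).1 = 0 :=
    le_antisymm hc' (N.exec_nonneg (fun a => Int.natCast_nonneg _) hl')
  set k : Letter A → ℕ := fun a => w.count a with hk
  set l : Letter A → ℕ := fun a => w'.count a with hl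
  have hkl : (fun a => (k a : ℤ)) - (fun a => (l a : ℤ)) ∈ N.totalKernel := by
    intro v
    refine AbelianProcessor.mem_kernel_of_smul_eq _ (hN v) (p v) ?_
    rw [exec_state, exec_state] at hyz
    have h1 : (N.proc v).toAbelianProcessor.grpElt (fun a => (k ⟨v, a⟩ : ℤ)) • p v =
        (N.proc v).toAbelianProcessor.grpElt (fun a => (l ⟨v, a⟩ : ℤ)) • p v :=
      Subtype.ext (congrFun hyz v)
    have h2 := (N.proc v).toAbelianProcessor.grpElt_add
      (fun a => ((fun a => (k a : ℤ)) - (fun a => (l a : ℤ))) ⟨v, a⟩) (fun a => (l ⟨v, a⟩ : ℤ))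
    have h3 : (fun a : A v => ((fun a => (k a : ℤ)) - (fun a => (l a : ℤ))) ⟨v, a⟩) +
        (fun a => (l ⟨v, a⟩ : ℤ)) = fun a => (k ⟨v, a⟩ : ℤ) := by
      funext a
      simp
    rw [h3] at h2
    rw [h2, mul_comm, mul_smul] at h1
    exact MulAction.injective _ h1
  -- The counts `k` and `l` need not lie in `K` separately. The vector `m = κ - l` completes both of
  -- them to nonnegative elements of `K`, whose production is read off from executions.
  set κ := N.kernelShift fun a => (l a : ℤ) with hκ
  have hκm := N.kernelShift_mem fun a => (l a : ℤ)
  rw [← hκ] at hκm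
  have hle : ∀ a, l a ≤ κ a := by
    intro a
    rw [hκ]
    have h1 : 1 ≤ Nat.card (N.proc a.1).toAbelianProcessor.Grp := Nat.card_pos
    simp only [kernelShift, Int.natAbs_natCast]
    exact Nat.le_mul_of_pos_left _ h1
  set m : Letter A → ℕ := κ - l with hm
  have hlm : l + m = κ := by
    funext a
    have := hle a
    simp only [hm, Pi.add_apply, Pi.sub_apply]
    omega
  have hlmK : (fun a => ((l + m) a : ℤ)) ∈ N.totalKernel := by rw [hlm]; exact hκm
  have hkmK : (fun a => ((k + m) a : ℤ)) ∈ N.totalKernel := by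
    convert AddSubgroup.add_mem _ hkl hlmK using 1
    funext a
    simp only [Pi.add_apply, Pi.sub_apply, Nat.cast_add]
    ring
  have hsub : (⟨_, hkl⟩ : N.totalKernel) = ⟨_, hkmK⟩ - ⟨_, hlmK⟩ := by
    refine Subtype.ext (funext fun a => ?_)
    change (k a : ℤ) - l a = ((k + m) a : ℕ) - ((l + m) a : ℕ)
    simp
  refine ⟨⟨_, hkl⟩, ?_⟩
  rw [hsub, productionMap_eq hN p, map_sub, productionAt_nat, productionAt_nat, ← hsub]
  -- From `p`, the net effect of `w` is to consume `y`, and that of `w'` to consume `z`, whatever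
  -- else is waiting; both end in the same state.
  have f1 : ∀ x' : Letter A → ℤ, N.exec w (x', p.state) = (x' - (fun a => (y a : ℤ)),
      (N.exec w (fun a => (y a : ℤ), p.state)).2) := by
    intro x'
    have := N.exec_shift w (fun a => (y a : ℤ)) (x' - fun a => (y a : ℤ)) p.state
    rw [add_sub_cancel, e1, zero_add] at this
    exact this
  have f2 : ∀ x' : Letter A → ℤ, N.exec w' (x', p.state) = (x' - (fun a => (z a : ℤ)),
      (N.exec w (fun a => (y a : ℤ), p.state)).2) := by
    intro x'
    have := N.exec_shift w' (fun a => (z a : ℤ)) (x' - fun a => (z a : ℤ)) p.state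
    rw [add_sub_cancel, e2, zero_add, ← hyz] at this
    exact this
  -- The common tail `m` is processed from the same state in both terms, so its contribution
  -- cancels.
  have g : N.productionNat p (k + m) - N.productionNat p (l + m) =
      ((fun a => (k a : ℤ)) - fun a => (y a : ℤ)) -
        ((fun a => (l a : ℤ)) - fun a => (z a : ℤ)) := by
    simp only [productionNat, localAct, exec_wordOf_add]
    rw [hk, hl, exec_wordOf_count, exec_wordOf_count, f1, f2, exec_fst_sub]
    funext a
    simp
    ring
  rw [g, hxyz]
  funext a
  simp only [Pi.sub_apply]
  ring

/-- The kernel of the homomorphism `ℤ ^ A → Crit N` is `(I - P) K`. -/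
theorem grpElt_globalProcessor_eq_one_iff (h : N.HaltsOnAllInputs) (hN : N.Irreducible)
    (x : Letter A → ℤ) : (globalProcessor h).grpElt x = 1 ↔
      ∃ k : N.totalKernel, x = k.1 - productionMap hN k := by
  refine ⟨exists_eq_sub_production h hN, ?_⟩
  rintro ⟨k, rfl⟩
  exact grpElt_sub_production h hN k

/-- Homotopic networks have isomorphic critical groups. -/
theorem Homotopic.nonempty_crit_mulEquiv {N' : AbelianNetwork.{uV, uE, uA, uQ'} V A}
    [∀ v, Finite (N'.Q v)] (H : Homotopic N N') (h : N.HaltsOnAllInputs)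
    (h' : N'.HaltsOnAllInputs) : Nonempty (Crit h ≃* Crit h') := by
  refine AbelianProcessor.nonempty_grp_mulEquiv _ _ fun x => ?_
  rw [grpElt_globalProcessor_eq_one_iff h H.irreducible,
    grpElt_globalProcessor_eq_one_iff h' H.irreducible']
  constructor
  · rintro ⟨⟨k, hk⟩, rfl⟩
    have hk' : k ∈ N'.totalKernel := H.kernel_eq ▸ hk
    exact ⟨⟨k, hk'⟩, by rw [H.production_eq k hk hk']⟩
  · rintro ⟨⟨k, hk'⟩, rfl⟩
    have hk : k ∈ N.totalKernel := H.kernel_eq ▸ hk'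
    exact ⟨⟨k, hk⟩, by rw [H.production_eq k hk hk']⟩

end Finite

end AbelianNetwork

/-! ### Criteria for homotopy and for halting -/

namespace AbelianNetwork

variable {V : Type uV} [Quiver.{uE + 1} V] {A : V → Type uA}
variable {N : AbelianNetwork.{uV, uE, uA, uQ} V A} [∀ v : V, Fintype (Quiver.Star v)]
variable [Fintype V] [∀ v, Fintype (A v)]

/-- Equality of production maps may be checked on nonnegative vectors. -/
theorem Homotopic.of_nat {N' : AbelianNetwork.{uV, uE, uA, uQ'} V A}
    [∀ v, Finite (N.Q v)] [∀ v, Finite (N'.Q v)] (hN : N.Irreducible) (hN' : N'.Irreducible)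
    (hK : N.totalKernel = N'.totalKernel)
    (hP : ∀ (k : Letter A → ℕ) (hk : (fun a => (k a : ℤ)) ∈ N.totalKernel)
      (hk' : (fun a => (k a : ℤ)) ∈ N'.totalKernel),
      productionMap hN ⟨_, hk⟩ = productionMap hN' ⟨_, hk'⟩) : Homotopic N N' where
  irreducible := hN
  irreducible' := hN'
  kernel_eq := hK
  production_eq k hk hk' := by
    have h1 := N.toNat_kernelShift_mem hk
    have h2 := N.kernelShift_mem k
    have h1' := h1
    have h2' := h2
    rw [hK] at h1' h2'
    have e : (fun a => ((k a + N.kernelShift k a).toNat : ℤ)) - (fun a => (N.kernelShift k a : ℤ))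
        = k := by
      funext a
      rw [Pi.sub_apply, Int.toNat_of_nonneg (N.add_kernelShift_nonneg k a)]
      ring
    have f : (⟨k, hk⟩ : N.totalKernel) = ⟨_, h1⟩ - ⟨_, h2⟩ := Subtype.ext e.symm
    have f' : (⟨k, hk'⟩ : N'.totalKernel) = ⟨_, h1'⟩ - ⟨_, h2'⟩ := Subtype.ext e.symm
    rw [f, f', map_sub, map_sub, hP _ h1 h1', hP _ h2 h2']

/-- A network halts on all inputs if there is a nonnegative potential, the sum of weights of the
waiting letters and of the states, that decreases with every step. -/
theorem haltsOnAllInputs_of_potential (c : Letter A → ℤ) (hc : 0 ≤ c) (ψ : ∀ v, N.Q v → ℤ)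
    (hψ : ∀ v q, 0 ≤ ψ v q)
    (hstep : ∀ (a : Letter A) (q : N.Q a.1),
      ∑ b, c b * N.sent a q b + ψ a.1 ((N.proc a.1).t a.2 q) + 1 ≤ c a + ψ a.1 q) :
    N.HaltsOnAllInputs := by
  classical
  -- Induction on an upper bound `n` for the potential. For `n = 0` no letter can be waiting: by
  -- `hstep`, a waiting letter together with the state of its processor would already contribute at
  -- least `1`.
  have key : ∀ (n : ℕ) (s : N.TotalState), 0 ≤ s.1 →
      ∑ b, c b * s.1 b + ∑ v, ψ v (s.2 v) ≤ n → ∃ w, N.IsLegal w s ∧ N.IsComplete w s := by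
    intro n
    induction n with
    | zero =>
      intro s hs hn
      by_cases h0 : s.1 ≤ 0
      · exact ⟨[], trivial, h0⟩
      · exfalso
        obtain ⟨a, ha⟩ : ∃ a, 0 < s.1 a := by
          by_contra! hcon
          exact h0 hcon
        have h1 := hstep a (s.2 a.1)
        have h2 : 0 ≤ ∑ b, c b * N.sent a (s.2 a.1) b :=
          Finset.sum_nonneg fun b _ => mul_nonneg (hc b) (N.sent_nonneg a _ b)
        have h3 := hψ a.1 ((N.proc a.1).t a.2 (s.2 a.1))
        have h4 : c a * s.1 a ≤ ∑ b, c b * s.1 b :=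
          Finset.single_le_sum (f := fun b => c b * s.1 b)
            (fun b _ => mul_nonneg (hc b) (hs b)) (Finset.mem_univ a)
        have h5 : ψ a.1 (s.2 a.1) ≤ ∑ v, ψ v (s.2 v) :=
          Finset.single_le_sum (f := fun v => ψ v (s.2 v)) (fun v _ => hψ v _)
            (Finset.mem_univ a.1)
        have h6 : c a * 1 ≤ c a * s.1 a := mul_le_mul_of_nonneg_left ha (hc a)
        push_cast at hn
        linarith
    | succ n ih =>
      intro s hs hn
      by_cases h0 : s.1 ≤ 0
      · exact ⟨[], trivial, h0⟩
      · obtain ⟨a, ha⟩ : ∃ a, 0 < s.1 a := by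
          by_contra! hcon
          exact h0 hcon
        have hl : N.IsLegal [a] s := ⟨ha, trivial⟩
        obtain ⟨w, hw, hw'⟩ := ih (N.step a s) (N.exec_nonneg hs hl) (by
          have h1 := hstep a (s.2 a.1)
          have h2 : ∑ b, c b * (N.step a s).1 b =
              ∑ b, c b * s.1 b - c a + ∑ b, c b * N.sent a (s.2 a.1) b := by
            simp only [step, Pi.add_apply, Pi.sub_apply, mul_add, mul_sub,
              Finset.sum_add_distrib, Finset.sum_sub_distrib]
            congr 2
            rw [Finset.sum_eq_single a]
            · simp
            · intro b _ hb
              simp [hb]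
            · simp
          have h3 : ∑ v, ψ v ((N.step a s).2 v) = ∑ v, ψ v (s.2 v) - ψ a.1 (s.2 a.1) +
              ψ a.1 ((N.proc a.1).t a.2 (s.2 a.1)) := by
            rw [← Finset.add_sum_erase _ _ (Finset.mem_univ a.1),
              ← Finset.add_sum_erase Finset.univ (fun v => ψ v (s.2 v)) (Finset.mem_univ a.1)]
            have : ∑ v ∈ Finset.univ.erase a.1, ψ v ((N.step a s).2 v) =
                ∑ v ∈ Finset.univ.erase a.1, ψ v (s.2 v) := by
              refine Finset.sum_congr rfl fun v hv => ?_
              simp only [step, Function.update_of_ne (Finset.ne_of_mem_erase hv)]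
            rw [this]
            simp only [step, Function.update_self]
            ring
          rw [h2, h3]
          push_cast at hn
          linarith)
        exact ⟨a :: w, ⟨ha, hw⟩, hw'⟩
  intro x q
  exact key (∑ b, c b * (x b : ℤ) + ∑ v, ψ v (q v)).toNat _ (fun a => Int.natCast_nonneg _)
    (Int.self_le_toNat _)

end AbelianNetwork

/-! ### Networks of cyclic processors -/

section Cyclic

variable {V : Type uV} [Quiver.{uE + 1} V]

/-- The network with one letter per vertex whose processors are cyclic. -/
abbrev cyclicNetwork (r : V → ℕ) (o : ∀ v, Quiver.Star v → ZMod (r v) → List Unit) :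
    AbelianNetwork.{uV, uE, 0, 0} V (fun _ => Unit) where
  Q v := ZMod (r v)
  proc v := cyclicProcessor (r v) (o v)

theorem ZMod.sum_range_natCast {B : Type*} [AddCommMonoid B] (r : ℕ) [NeZero r] (f : ZMod r → B) :
    ∑ i ∈ Finset.range r, f i = ∑ z, f z :=
  Finset.sum_bij' (fun i _ => (i : ZMod r)) (fun z _ => z.val)
    (fun _ _ => Finset.mem_univ _) (fun z _ => Finset.mem_range.2 z.val_lt)
    (fun _ hi => ZMod.val_cast_of_lt (Finset.mem_range.1 hi)) (fun z _ => ZMod.natCast_zmod_val z)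
    (fun _ _ => rfl)

namespace cyclicNetwork

variable [∀ v : V, Fintype (Quiver.Star v)]
variable {r : V → ℕ} (o : ∀ v, Quiver.Star v → ZMod (r v) → List Unit)

open AbelianNetwork

theorem count_map_sigmaMk [DecidableEq V] {_ : DecidableEq (Letter fun _ : V => Unit)} (u : V)
    (b : Letter fun _ : V => Unit) (l : List Unit) :
    (l.map fun x => (⟨u, x⟩ : Letter fun _ : V => Unit)).count b =
      if u = b.1 then l.length else 0 := by
  obtain ⟨v, ⟨⟩⟩ := b
  rw [List.eq_replicate_of_mem (a := ()) (l := l) (fun _ _ => rfl), List.map_replicate,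
    List.count_replicate]
  by_cases h : u = v
  · subst h; simp
  · have : ¬ ((⟨u, ()⟩ : Letter fun _ : V => Unit) = ⟨v, ()⟩) :=
      fun h' => h (congrArg Sigma.fst h')
    simp [h]

open Classical in
theorem sent_apply (v : V) (q : ZMod (r v)) (b : Letter fun _ : V => Unit) :
    (cyclicNetwork r o).sent ⟨v, ()⟩ q b =
      ∑ e : Quiver.Star v, if e.1 = b.1 then ((o v e q).length : ℤ) else 0 := by
  unfold sent
  refine Finset.sum_congr rfl fun e _ => ?_
  refine (congrArg (Nat.cast (R := ℤ)) (count_map_sigmaMk e.1 b (o v e q))).trans ?_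
  split_ifs <;> simp

variable [∀ v, NeZero (r v)]

/-- The letters sent by the processor at `v` in a full cycle of its states. -/
noncomputable def cycleSent (v : V) : (Letter fun _ : V => Unit) → ℤ :=
  ∑ z : ZMod (r v), (cyclicNetwork r o).sent ⟨v, ()⟩ z

open Classical in
theorem cycleSent_apply (v : V) (b : Letter fun _ : V => Unit) :
    cycleSent o v b =
      ∑ e : Quiver.Star v, if e.1 = b.1 then ∑ z, ((o v e z).length : ℤ) else 0 := by
  rw [cycleSent, Finset.sum_apply]
  simp only [sent_apply]
  rw [Finset.sum_comm]
  refine Finset.sum_congr rfl fun e _ => ?_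
  split_ifs <;> simp

-- The successive letters meet the states `q v, q v + 1, …`, and each message depends only on the
-- state in which it is sent.
open Classical in
theorem exec_replicate_fst (v : V) (n : ℕ) (x : (Letter fun _ : V => Unit) → ℤ)
    (q : (cyclicNetwork r o).State) :
    ((cyclicNetwork r o).exec (List.replicate n ⟨v, ()⟩) (x, q)).1 =
      x - n • Pi.single ⟨v, ()⟩ 1 +
        ∑ i ∈ Finset.range n, (cyclicNetwork r o).sent ⟨v, ()⟩ ((q v : ZMod (r v)) + i) := by
  induction n generalizing x q with
  | zero => simp [exec]
  | succ n ih =>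
    rw [List.replicate_succ, exec, step, ih, Finset.sum_range_succ', succ_nsmul]
    have : ∀ i : ℕ, (Function.update q v (((cyclicNetwork r o).proc v).t () (q v)) v : ZMod (r v)) + i
        = (q v : ZMod (r v)) + ((i + 1 : ℕ) : ZMod (r v)) := by
      intro i
      rw [Function.update_self]
      change (q v : ZMod (r v)) + 1 + i = _
      push_cast
      ring
    simp only [this, Nat.cast_zero, add_zero]
    funext a
    simp only [Pi.add_apply, Pi.sub_apply, Pi.smul_apply, Pi.single_apply]
    split_ifs <;> abel

theorem gen_pow_smul (v : V) (n : ℕ) (q : ZMod (r v)) :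
    (((cyclicNetwork r o).proc v).toAbelianProcessor.gen () ^ n • q : ZMod (r v)) = q + n := by
  induction n generalizing q with
  | zero => simp
  | succ n ih =>
    rw [pow_succ, mul_smul, ih]
    change q + 1 + (n : ZMod (r v)) = _
    push_cast
    ring

theorem irreducible : (cyclicNetwork r o).Irreducible := by
  intro v
  refine ⟨⟨(0 : ZMod (r v))⟩, fun q q' => ?_⟩
  refine ⟨((cyclicNetwork r o).proc v).toAbelianProcessor.gen () ^
    (ZMod.val (n := r v) (q' - q : ZMod (r v))), 1, ?_⟩
  rw [one_smul]
  refine (gen_pow_smul o v _ q).trans ?_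
  rw [ZMod.natCast_zmod_val]
  exact add_sub_cancel (G := ZMod (r v)) q q'

instance (v : V) : Finite ((cyclicNetwork r o).Q v) := inferInstanceAs (Finite (ZMod (r v)))

theorem grpElt_natCast_smul (v : V) (k : Unit → ℕ)
    (q : ((cyclicNetwork r o).proc v).toAbelianProcessor.Rec) :
    (((cyclicNetwork r o).proc v).toAbelianProcessor.grpElt (fun a => (k a : ℤ)) • q).1 =
      (q.1 + (k () : ZMod (r v)) : ZMod (r v)) := by
  rw [AbelianProcessor.grpElt_natCast, RecElts.of_smul, Fintype.prod_unique]
  exact gen_pow_smul o v _ q.1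

variable [Fintype V]

/-- At `v` the vector `k` acts as translation by `k ⟨v, ()⟩` on `ℤ/r_v`. A single recurrent state,
here `e_v • 0`, tests whether this translation is trivial. -/
theorem natCast_mem_totalKernel_iff (k : (Letter fun _ : V => Unit) → ℕ) :
    (fun a => (k a : ℤ)) ∈ (cyclicNetwork r o).totalKernel ↔ ∀ v, r v ∣ k ⟨v, ()⟩ := by
  refine forall_congr' fun v => ?_
  rw [← ZMod.natCast_eq_zero_iff]
  constructor
  · intro h
    have h1 := congrArg Subtype.val
      (h ⟨minIdem ((cyclicNetwork r o).proc v).toAbelianProcessor.transitionMonoid •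
        (0 : ZMod (r v)), _, rfl⟩)
    exact (add_eq_left (M := ZMod (r v))).1
      ((grpElt_natCast_smul o v (fun a => k ⟨v, a⟩) _).symm.trans h1)
  · intro h q
    refine Subtype.ext ((grpElt_natCast_smul o v (fun a => k ⟨v, a⟩) q).trans ?_)
    rw [h]
    exact add_zero (M := ZMod (r v)) q.1

-- A run of `r v` letters passes through every state of `ℤ/r_v` exactly once, wherever it starts.
open Classical in
theorem productionNat_single (p : (cyclicNetwork r o).LocRec) (v : V) :
    (cyclicNetwork r o).productionNat p (Pi.single ⟨v, ()⟩ (r v)) = cycleSent o v := by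
  have hw : (wordOf (Pi.single (⟨v, ()⟩ : Letter fun _ : V => Unit) (r v))).Perm
      (List.replicate (r v) ⟨v, ()⟩) := by
    rw [List.perm_iff_count]
    intro a
    refine Eq.trans (by convert count_wordOf _ a) ?_
    rw [List.count_replicate]
    by_cases h : a = ⟨v, ()⟩
    · subst h; simp
    · simp [h, Ne.symm h]
  rw [productionNat, localAct, exec_perm _ hw]
  refine (exec_replicate_fst o v (r v) _ p.state).trans ?_
  have h1 : ((fun a => ((Pi.single (⟨v, ()⟩ : Letter fun _ : V => Unit) (r v) : _ → ℕ) a : ℤ)) +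
      ((0, p.state) : (cyclicNetwork r o).TotalState).1 -
      r v • Pi.single ⟨v, ()⟩ 1) = 0 := by
    funext a
    by_cases h : a = ⟨v, ()⟩
    · subst h; simp
    · simp [h]
  rw [h1, zero_add, ZMod.sum_range_natCast (r v) fun z =>
    (cyclicNetwork r o).sent ⟨v, ()⟩ ((p.state v : ZMod (r v)) + z)]
  exact Equiv.sum_comp (Equiv.addLeft (p.state v : ZMod (r v)))
    fun z => (cyclicNetwork r o).sent ⟨v, ()⟩ z

/-- The vector `k` is a combination of the `r_v 1_v` with coefficients `k_v / r_v`, an exact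
division on the total kernel. -/
theorem productionMap_natCast (h : (cyclicNetwork r o).Irreducible)
    (k : (Letter fun _ : V => Unit) → ℕ)
    (hk : (fun a => (k a : ℤ)) ∈ (cyclicNetwork r o).totalKernel) :
    productionMap h ⟨_, hk⟩ = ∑ v, (k ⟨v, ()⟩ / r v) • cycleSent o v := by
  classical
  obtain ⟨p⟩ := LocRec.nonempty h
  have hs : ∀ v, (fun a => ((Pi.single (⟨v, ()⟩ : Letter fun _ : V => Unit) (r v) : _ → ℕ) a : ℤ)) ∈
      (cyclicNetwork r o).totalKernel := by
    intro v
    rw [natCast_mem_totalKernel_iff]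
    intro u
    by_cases hu : u = v
    · subst hu; simp
    · have : (⟨u, ()⟩ : Letter fun _ : V => Unit) ≠ ⟨v, ()⟩ := fun h' => hu (congrArg Sigma.fst h')
      simp [this]
  have hsum : (⟨_, hk⟩ : (cyclicNetwork r o).totalKernel) =
      ∑ v, (k ⟨v, ()⟩ / r v) • ⟨_, hs v⟩ := by
    refine Subtype.ext (funext fun a => ?_)
    obtain ⟨u, ⟨⟩⟩ := a
    rw [AddSubgroup.val_finsetSum, Finset.sum_apply, Finset.sum_eq_single u]
    · have := Nat.div_mul_cancel ((natCast_mem_totalKernel_iff o k).1 hk u)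
      simp only [AddSubgroup.coe_nsmul, Pi.smul_apply, Pi.single_eq_same, nsmul_eq_mul]
      exact_mod_cast this.symm
    · intro v _ hv
      have : (⟨u, ()⟩ : Letter fun _ : V => Unit) ≠ ⟨v, ()⟩ :=
        fun h' => hv (congrArg Sigma.fst h').symm
      simp [this]
    · simp
  rw [hsum, map_sum]
  refine Finset.sum_congr rfl fun v _ => ?_
  rw [map_nsmul, productionMap_eq h p, productionAt_nat, productionNat_single]

/-- Cyclic networks that send the same letters in each full cycle are homotopic. -/
theorem homotopic (o' : ∀ v, Quiver.Star v → ZMod (r v) → List Unit)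
    (h : ∀ v, cycleSent o v = cycleSent o' v) :
    Homotopic (cyclicNetwork r o) (cyclicNetwork r o') :=
  -- The total kernels agree by `rfl`: they involve the transition maps but not the messages.
  Homotopic.of_nat (irreducible o) (irreducible o') rfl fun k hk hk' => by
    rw [productionMap_natCast, productionMap_natCast]
    simp only [h]

/-- A cyclic network halts on all inputs if there are weights of the letters such that each
processor, in a full cycle, loses at least `1` per letter processed. -/
theorem haltsOnAllInputs (c : (Letter fun _ : V => Unit) → ℤ) (hc : ∀ a, 1 ≤ c a)
    (h : ∀ v, ∑ b, c b * cycleSent o v b ≤ r v * (c ⟨v, ()⟩ - 1)) :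
    (cyclicNetwork r o).HaltsOnAllInputs := by
  set ω : ∀ v, ZMod (r v) → ℤ := fun v z =>
    ∑ b, c b * (cyclicNetwork r o).sent ⟨v, ()⟩ z b with hω
  have hω0 : ∀ v z, 0 ≤ ω v z := fun v z =>
    Finset.sum_nonneg fun b _ => mul_nonneg (by linarith [hc b]) (sent_nonneg _ _ _ b)
  have hωs : ∀ v, ∑ i ∈ Finset.range (r v), ω v i ≤ r v * (c ⟨v, ()⟩ - 1) := by
    intro v
    refine le_trans (le_of_eq ?_) (h v)
    rw [ZMod.sum_range_natCast]
    simp only [hω, cycleSent, Finset.sum_apply, Finset.mul_sum]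
    exact Finset.sum_comm
  -- State `z` is charged `c - 1` for each letter absorbed since state `0`, plus the weight of the
  -- messages still to be sent in the current cycle; the latter keeps the potential nonnegative. An
  -- ordinary step then lowers the total by exactly `1`.
  refine haltsOnAllInputs_of_potential c (fun a => by have := hc a; simp only [Pi.zero_apply]; omega)
    (fun v (z : ZMod (r v)) => (z.val : ℤ) * (c ⟨v, ()⟩ - 1) +
      ∑ i ∈ Finset.Ico z.val (r v), ω v i) ?_ ?_
  · intro v z
    have := hc ⟨v, ()⟩
    exact add_nonneg (mul_nonneg (by positivity) (by linarith))
      (Finset.sum_nonneg fun _ _ => hω0 _ _)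
  · rintro ⟨v, ⟨⟩⟩ (q : ZMod (r v))
    change ω v q + (((q + 1 : ZMod (r v)).val : ℤ) * (c ⟨v, ()⟩ - 1) +
      ∑ i ∈ Finset.Ico (q + 1 : ZMod (r v)).val (r v), ω v i) + 1 ≤ c ⟨v, ()⟩ +
      ((q.val : ℤ) * (c ⟨v, ()⟩ - 1) + ∑ i ∈ Finset.Ico q.val (r v), ω v i)
    have hq := q.val_lt
    rw [Finset.sum_eq_sum_Ico_succ_bot hq, ZMod.natCast_zmod_val]
    by_cases hlt : q.val + 1 < r v
    · have : (q + 1 : ZMod (r v)).val = q.val + 1 := by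
        have h1 : q + 1 = ((q.val + 1 : ℕ) : ZMod (r v)) := by
          push_cast
          rw [ZMod.natCast_zmod_val]
        rw [h1, ZMod.val_cast_of_lt hlt]
      rw [this]
      push_cast
      linarith
    -- The return to state `0` is the only step that uses the hypothesis on full cycles.
    · have hr : q.val + 1 = r v := by omega
      have : q + 1 = (0 : ZMod (r v)) := by
        have h1 : q + 1 = ((q.val + 1 : ℕ) : ZMod (r v)) := by
          push_cast
          rw [ZMod.natCast_zmod_val]
        rw [h1, hr, ZMod.natCast_self]
      rw [this, ZMod.val_zero, hr, Finset.Ico_self, Finset.sum_empty, ← Finset.range_eq_Ico]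
      have h2 := hωs v
      have h3 : (r v : ℤ) = q.val + 1 := by exact_mod_cast hr.symm
      rw [h3] at h2
      push_cast
      linarith

end cyclicNetwork

end Cyclic

/-! ### Weights on a graph with a global sink -/

section Sink

variable {V : Type uV} [Quiver.{uE + 1} V]

/-- Paths are built by appending at the end, so the first edge is reached by induction. If the last
edge already starts at `v`, it alone serves and the loop before it is dropped. -/
theorem exists_star_path_length_lt {v s : V} (p : Quiver.Path v s) (h : v ≠ s) :
    ∃ (e : Quiver.Star v) (p' : Quiver.Path e.1 s), p'.length < p.length := by
  induction p with
  | nil => exact absurd rfl h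
  | @cons b c p e ih =>
    by_cases hb : v = b
    · subst hb
      exact ⟨⟨_, e⟩, Quiver.Path.nil, by simp⟩
    · obtain ⟨e', p', hp'⟩ := ih hb
      exact ⟨e', p'.cons e, by simpa using hp'⟩

/-- A height function that decreases along some outgoing edge of every vertex but the sink. -/
theorem exists_height (s : V) [hs : IsGlobalSink s] :
    ∃ ℓ : V → ℕ, ∀ v, v ≠ s → ∃ e : Quiver.Star v, ℓ e.1 < ℓ v := by
  classical
  have hne : ∀ v, Nonempty (Quiver.Path v s) := fun v => by
    by_cases h : v = s
    · subst h; exact ⟨Quiver.Path.nil⟩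
    · exact hs.reach v h
  -- The height is the directed distance to `s`; the infimum is attained.
  refine ⟨fun v => ⨅ p : Quiver.Path v s, p.length, fun v hv => ?_⟩
  have := hne v
  obtain ⟨p, hp⟩ := ciInf_mem (fun p : Quiver.Path v s => p.length)
  obtain ⟨e, p', hp'⟩ := exists_star_path_length_lt p hv
  refine ⟨e, ?_⟩
  dsimp only at hp ⊢
  rw [← hp]
  exact (ciInf_le (OrderBot.bddBelow _) p').trans_lt hp'

variable [∀ v : V, Fintype (Quiver.Star v)] [Fintype V]

/-- Positive weights whose mean over the outgoing edges of a vertex other than the sink is at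
most the weight of the vertex minus `1`. -/
theorem exists_superharmonic (s : V) [IsGlobalSink s] :
    ∃ c : V → ℤ, (∀ v, 1 ≤ c v) ∧
      ∀ v, v ≠ s → ∑ e : Quiver.Star v, c e.1 ≤ outdegree v * (c v - 1) := by
  classical
  obtain ⟨ℓ, hℓ⟩ := exists_height s
  set L := ∑ v, ℓ v with hL
  set D : ℤ := 2 * ∑ v : V, (outdegree v : ℤ) + 1 with hD
  have hℓL : ∀ v, ℓ v ≤ L := fun v =>
    Finset.single_le_sum (f := ℓ) (fun _ _ => Nat.zero_le _) (Finset.mem_univ v)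
  have hdD : ∀ v, 2 * (outdegree v : ℤ) ≤ D := fun v => by
    have := Finset.single_le_sum (f := fun v : V => (outdegree v : ℤ))
      (fun _ _ => Int.natCast_nonneg _) (Finset.mem_univ v)
    linarith
  have hD1 : 1 ≤ D := by
    have : 0 ≤ ∑ v : V, (outdegree v : ℤ) := Finset.sum_nonneg fun _ _ => Int.natCast_nonneg _
    linarith
  have hpow : ∀ n, 1 ≤ D ^ n := fun n => one_le_pow₀ hD1
  -- The claim at `v` becomes `d_v D ^ (L - ℓ v) + d_v ≤ ∑ D ^ (L - ℓ e.1)`. One edge leading to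
  -- smaller height contributes at least `D * D ^ (L - ℓ v)`, which is enough because `D ≥ 2 d_v`.
  -- Taking `L ≥ ℓ v` keeps the exponents free of truncation.
  refine ⟨fun v => D ^ L + 1 - D ^ (L - ℓ v), fun v => ?_, fun v hv => ?_⟩
  · have : D ^ (L - ℓ v) ≤ D ^ L := pow_le_pow_right₀ hD1 (Nat.sub_le _ _)
    linarith
  · obtain ⟨e, he⟩ := hℓ v hv
    have h1 : D ^ (L - ℓ v) * D ≤ ∑ e : Quiver.Star v, D ^ (L - ℓ e.1) := by
      refine le_trans ?_ (Finset.single_le_sum (f := fun e : Quiver.Star v => D ^ (L - ℓ e.1))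
        (fun e _ => zero_le_one.trans (hpow _)) (Finset.mem_univ e))
      rw [← pow_succ]
      refine pow_le_pow_right₀ hD1 ?_
      have := hℓL v
      omega
    rw [Finset.sum_sub_distrib, Finset.sum_const, Finset.card_univ, nsmul_eq_mul]
    change (outdegree v : ℤ) * _ - _ ≤ _
    have h2 := hpow (L - ℓ v)
    have h3 := hdD v
    have h4 : D ^ (L - ℓ v) * (2 * (outdegree v : ℤ)) ≤ D ^ (L - ℓ v) * D :=
      mul_le_mul_of_nonneg_left h3 (by linarith)
    have h5 : (outdegree v : ℤ) * 1 ≤ outdegree v * D ^ (L - ℓ v) :=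
      mul_le_mul_of_nonneg_left h2 (Int.natCast_nonneg _)
    linarith

namespace cyclicNetwork

open AbelianNetwork

variable (s : V) [IsGlobalSink s]
  (o : ∀ v, Quiver.Star v → ZMod (threshold s v) → List Unit)

/-- A cyclic network halts on all inputs if the sink sends nothing and every other processor
sends one letter along each outgoing edge per full cycle. -/
theorem haltsOnAllInputs_of_sink [DecidableEq V]
    (ho : ∀ v e, ∑ z, ((o v e z).length : ℤ) = if v = s then 0 else 1) :
    (cyclicNetwork (threshold s) o).HaltsOnAllInputs := by
  classical
  obtain ⟨c, hc1, hc⟩ := exists_superharmonic s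
  refine haltsOnAllInputs o (fun a => c a.1) (fun a => hc1 a.1) fun v => ?_
  have hsum : ∑ b : Letter (fun _ : V => Unit), c b.1 * cycleSent o v b =
      ∑ e : Quiver.Star v, c e.1 * if v = s then 0 else 1 := by
    simp only [cycleSent_apply, Finset.mul_sum, ho]
    rw [Finset.sum_comm]
    refine Finset.sum_congr rfl fun e _ => ?_
    rw [Finset.sum_eq_single ⟨e.1, ()⟩]
    · simp
    · rintro ⟨u, ⟨⟩⟩ _ hu
      have : e.1 ≠ u := by
        rintro rfl
        exact hu rfl
      simp [this]
    · simp
  rw [hsum]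
  -- The sink sends nothing, so only `c s ≥ 1` is needed there; elsewhere the bound is
  -- superharmonicity, since `threshold s v` is the outdegree.
  by_cases hv : v = s
  · have := hc1 v
    simp only [hv, if_true, mul_zero, Finset.sum_const_zero]
    rw [← hv]
    exact mul_nonneg (Int.natCast_nonneg _) (by linarith)
  · have := hc v hv
    simpa only [threshold, hv, if_false, mul_one] using this

end cyclicNetwork

end Sink

/-! ### Sandpile and rotor networks: one letter per edge and cycle -/

section Examples

variable {V : Type uV} [Quiver.{uE + 1} V] [∀ v : V, Fintype (Quiver.Star v)]
variable (s : V) [IsGlobalSink s]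

-- For `v ≠ s` the only state that sends is `-1`, that is `d_v - 1`.
open Classical in
theorem sum_length_sand (v : V) :
    ∑ z : ZMod (threshold s v),
      ((if v ≠ s ∧ z + 1 = 0 then [()] else [] : List Unit).length : ℤ) =
        if v = s then 0 else 1 := by
  by_cases hv : v = s
  · simp [hv]
  · rw [Finset.sum_eq_single (-1)]
    · simp [hv]
    · intro z _ hz
      have : ¬ z + 1 = 0 := fun h => hz (eq_neg_of_add_eq_zero_left h)
      simp [this]
    · simp

-- For `v ≠ s` the edge `e` is used only in the state given by its position, which is less than the
-- period.
open Classical in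
theorem sum_length_rotor (ord : ∀ v : V, Quiver.Star v ≃ Fin (outdegree v)) (v : V)
    (e : Quiver.Star v) :
    ∑ z : ZMod (threshold s v),
      ((if v ≠ s ∧ z.val = (ord v e : ℕ) then [()] else [] : List Unit).length : ℤ) =
        if v = s then 0 else 1 := by
  by_cases hv : v = s
  · simp [hv]
  · have hlt : (ord v e : ℕ) < threshold s v := by
      rw [threshold, if_neg hv]
      exact (ord v e).2
    rw [Finset.sum_eq_single ((ord v e : ℕ) : ZMod (threshold s v))]
    · simp [hv, ZMod.val_cast_of_lt hlt]
    · intro z _ hz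
      have : ¬ z.val = (ord v e : ℕ) := fun h => hz (by rw [← h, ZMod.natCast_zmod_val])
      simp [this]
    · simp

variable [Fintype V]

theorem sand_haltsOnAllInputs : (sand s).HaltsOnAllInputs := by
  classical
  exact cyclicNetwork.haltsOnAllInputs_of_sink s _ fun v _ => sum_length_sand s v

theorem rotor_haltsOnAllInputs (ord : ∀ v : V, Quiver.Star v ≃ Fin (outdegree v)) :
    (rotor s ord).HaltsOnAllInputs := by
  classical
  exact cyclicNetwork.haltsOnAllInputs_of_sink s _ (sum_length_rotor s ord)

theorem rotor_homotopic_sand (ord : ∀ v : V, Quiver.Star v ≃ Fin (outdegree v)) :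
    AbelianNetwork.Homotopic (rotor s ord) (sand s) := by
  classical
  -- The two networks differ only in when, within a cycle, the letter along each edge is sent; the
  -- totals per cycle agree.
  refine cyclicNetwork.homotopic (r := threshold s) _ _ fun v => ?_
  funext b
  rw [cyclicNetwork.cycleSent_apply, cyclicNetwork.cycleSent_apply]
  simp only [sum_length_sand, sum_length_rotor]

end Examples

theorem corollary3p13 (V : Type uV) [Quiver.{uE + 1} V] [Fintype V]
    [∀ v : V, Fintype (Quiver.Star v)] :
    (∀ (A : V → Type uA) [∀ v, Fintype (A v)]
        (N : AbelianNetwork.{uV, uE, uA, uQ} V A) (N' : AbelianNetwork.{uV, uE, uA, uQ'} V A)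
        [∀ v, Finite (N.Q v)] [∀ v, Finite (N'.Q v)]
        (h : N.HaltsOnAllInputs) (h' : N'.HaltsOnAllInputs),
        AbelianNetwork.Homotopic N N' →
          Nonempty (AbelianNetwork.Crit h ≃* AbelianNetwork.Crit h')) ∧
    (∀ (s : V) [IsGlobalSink s] (ord : ∀ v : V, Quiver.Star v ≃ Fin (outdegree v)),
        AbelianNetwork.Homotopic (rotor s ord) (sand s) ∧
        ∃ (hR : (rotor s ord).HaltsOnAllInputs) (hS : (sand s).HaltsOnAllInputs),
          Nonempty (AbelianNetwork.Crit hR ≃* AbelianNetwork.Crit hS)) := by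
  refine ⟨fun A _ N N' _ _ h h' H => H.nonempty_crit_mulEquiv h h', fun s _ ord => ?_⟩
  exact ⟨rotor_homotopic_sand s ord, rotor_haltsOnAllInputs s ord, sand_haltsOnAllInputs s,
    (rotor_homotopic_sand s ord).nonempty_crit_mulEquiv _ _⟩
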